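/- Let $F$ be an algebraically closed field of characteristic $0$ and $k\ge 1$. Let $G=\mathbb Z_2^{2k}=(\mathbb Z_2\times\mathbb Z_2)^k$ with elements $a=(a_1,\dots,a_{2k})$, let $\beta(a,b)=(-1)^{\sum_{i=1}^k(a_{2i}b_{2i-1}-a_{2i-1}b_{2i})}$, which is a nonsingular alternating bicharacter $G\times G\to F^\times$ (its radical $\mathrm{Rad}(\beta)=\{g:\beta(g,h)=1\ \forall h\}$ is $0$), and let $\xi(a,b)=(-1)^{\sum_{i=1}^k a_{2i}b_{2i-1}}$, a 2-cocycle with $\xi(a,b)\xi(b,a)^{-1}=\beta(a,b)$. The twisted group algebra $F^\xi G$ has basis $u_a$ $(a\in G)$ and product $u_au_b=\xi(a,b)u_{a+b}$. Define $f_0,f_1:G\to\mathbb Z_2$ by $$f_0(a)=\sum_{i=1}^k a_{2i-1}a_{2i},\qquad f_1(a)=a_1^2+a_2^2+\sum_{i=1}^k a_{2i-1}a_{2i},$$ and for $j=0,1$ put $R_j^-=\{a\in G\setminus\{0\}: f_j(a)=1\}$ and $R_j^+=\{a\in G: f_j(a)=0\}$. A set $R\subseteq G$ is a skew root system of Lie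 type in $(G,\beta)$ if $\beta$ is nontrivial, $R\cap\mathrm{Rad}(\beta)=\emptyset$, $R$ generates $G$, $R=-R$, and $a,b\in R$, $\beta(a,b)\ne 1$ imply $a+b\in R$; it is a skew root system of Jordan type if $R$ generates $G$, $R=-R$, and $a,b\in R$, $\beta(a,b)\neq -1$ imply $a+b\in R$. Then $L(R)=\bigoplus_{a\in R}Fu_a$ (in the Lie case) is a Lie subalgebra of $F^\xi G$ under $[x,y]=xy-yx$, and $J(R)=\bigoplus_{a\in R}Fu_a$ (in the Jordan case) is a Jordan subalgebra of $F^\xi G$ under $x\circ y=\frac12(xy+yx)$. Let $X=\begin{pmatrix}-1&0\\0&1\end{pmatrix}$, $Y=\begin{pmatrix}0&1\\1&0\end{pmatrix}$, $\Phi_1=\begin{pmatrix}0&1\\-1&0\end{pmatrix}$ and $M=M(2,F)^{\otimes k}\cong M(2^k,F)$ (Kronecker product). Then $M$ is $G$-graded by the lines $M_a=F\cdot X^{a_1}Y^{a_2}\otimes\cdots\otimes X^{a_{2k-1}}Y^{a_{2k}}$, and there is an algebra isomorphism $\psi:F^\xi G\to M$ with $\psi(u_a)=X^{a_1}Y^{a_2}\otimes\cdots\otimes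 X^{a_{2k-1}}Y^{a_{2k}}$ for all $a$. Given nonsingular symmetric or skew-symmetric forms $\phi_i$ on $F^2$ with matrices $\Phi^{(i)}$ $(1\le i\le k)$, let $*=*_1\otimes\cdots\otimes *_k$, where $Z^{*_i}=(\Phi^{(i)})^{-1}Z^t\Phi^{(i)}$ is the adjoint with respect to $\phi_i$. Put $K(M,*)=\{x: x^*=-x\}$, a Lie algebra under $[x,y]=xy-yx$, and $H(M,*)=\{x:x^*=x\}$, a Jordan algebra under $x\circ y=\frac12(xy+yx)$. (1) Let $\Phi^{(i)}=I_2$ for all $i$. Under $M\cong M(2^k,F)$, $*$ is the adjoint with respect to the nonsingular symmetric form $\phi_1\otimes\cdots\otimes\phi_k$. One has $K(M,*)\cong so(2^k,F)$, and $H(M,*)$ is isomorphic to the Jordan algebra $H(F_{2^k})$ of symmetric $2^k\times 2^k$ matrices. Moreover: (1.1) $M_a^*=M_a$ for all $a$, so the grading of $M$ induces $G$-gradings of $K(M,*)$ and $H(M,*)$; the support of $K(M,*)$ is $R_0^-$ and the support of $H(M,*)$ is $R_0^+$. (1.2) If $k\ge2$, then $R_0^-$ is a skew root system of Lie type in $(G,\beta)$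 and $\psi$ restricts to a Lie algebra isomorphism $L(R_0^-)\to K(M,*)$; hence $L(R_0^-)\cong so(2^k,F)$. For all $k\ge 1$, $R_0^+$ is a skew root system of Jordan type in $(G,\beta)$ and $\psi$ restricts to a Jordan algebra isomorphism $J(R_0^+)\to H(M,*)$. (2) Let $\Phi^{(1)}=\Phi_1$ and $\Phi^{(i)}=I_2$ for $i>1$. Under $M\cong M(2^k,F)$, $*$ is the adjoint with respect to the nonsingular skew-symmetric form $\phi_1\otimes\cdots\otimes\phi_k$. One has $K(M,*)\cong sp(2^k,F)$, and $H(M,*)$ is isomorphic to the Jordan algebra $H(Q_{2^k})$ of $2^k\times2^k$ matrices that are symmetric with respect to the symplectic involution $Z\mapsto J^{-1}Z^tJ$, where $J$ is the matrix of the canonical skew-symmetric form. Moreover: (2.1) $M_a^*=M_a$ for all $a$, so the grading of $M$ induces $G$-gradings of $K(M,*)$ and $H(M,*)$; the support of $K(M,*)$ is $R_1^-$ and the support of $H(M,*)$ is $R_1^+$. (2.2) For all $k\ge1$, $R_1^-$ is a skew root system of Lie type in $(G,\beta)$ and $\psi$ restricts to a Lie algebra isomorphism $L(R_1^-)\to K(M,*)$;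 hence $L(R_1^-)\cong sp(2^k,F)$. If $k\ge2$, then $R_1^+$ is a skew root system of Jordan type in $(G,\beta)$ and $\psi$ restricts to a Jordan algebra isomorphism $J(R_1^+)\to H(M,*)$. -/

import Mathlib

attribute [local instance] LieRing.ofAssociativeRing

namespace SkewRoot

noncomputable section

/-! ### Symplectic abelian groups, 2-cocycles, twisted group algebras -/

/-- An alternating bicharacter `β : G × G → Fˣ` on an additive abelian group `G`;
the pair `(G, β)` is a symplectic abelian group. -/
structure AltBichar (G F : Type*) [AddCommGroup G] [Field F] where
  toFun : G → G → Fˣ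
  map_add_left : ∀ a b c, toFun (a + b) c = toFun a c * toFun b c
  map_add_right : ∀ a b c, toFun a (b + c) = toFun a b * toFun a c
  map_self : ∀ a, toFun a a = 1

/-- The radical of `(G, β)`. -/
def AltBichar.rad {G F : Type*} [AddCommGroup G] [Field F] (β : AltBichar G F) : Set G :=
  {g | ∀ h, β.toFun g h = 1}

/-- `(G, β)` is nonsingular if its radical is zero. -/
def AltBichar.Nonsingular {G F : Type*} [AddCommGroup G] [Field F] (β : AltBichar G F) : Prop :=
  β.rad = {0}

/-- A 2-cocycle of `G` with values in `Fˣ` (trivial action). -/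
structure TwoCocycle (G F : Type*) [AddCommGroup G] [Field F] where
  toFun : G → G → Fˣ
  cocycle : ∀ a b c, toFun a b * toFun (a + b) c = toFun b c * toFun a (b + c)

/-- `ξ` corresponds to `β`: `ξ(a,b) ξ(b,a)⁻¹ = β(a,b)`. -/
def TwoCocycle.CorrespondsTo {G F : Type*} [AddCommGroup G] [Field F]
    (ξ : TwoCocycle G F) (β : AltBichar G F) : Prop :=
  ∀ a b, ξ.toFun a b * (ξ.toFun b a)⁻¹ = β.toFun a b

/-- The twisted group algebra `F^ξ G`: the vector space with basis `u_a` (`a ∈ G`) and the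
multiplication `u_a u_b = ξ(a,b) u_{a+b}`. -/
def TwistedGroupAlgebra {G F : Type*} [AddCommGroup G] [Field F] (_ξ : TwoCocycle G F) : Type _ :=
  G →₀ F

namespace TwistedGroupAlgebra

variable {G F : Type*} [AddCommGroup G] [Field F] {ξ : TwoCocycle G F}

instance : AddCommGroup (TwistedGroupAlgebra ξ) := inferInstanceAs (AddCommGroup (G →₀ F))

instance : Module F (TwistedGroupAlgebra ξ) := inferInstanceAs (Module F (G →₀ F))

/-- The basis of the twisted group algebra. -/
def basis (ξ : TwoCocycle G F) : Module.Basis G F (TwistedGroupAlgebra ξ) :=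
  ⟨LinearEquiv.refl F (G →₀ F)⟩

/-- The basis vector `u_a`. -/
def u (ξ : TwoCocycle G F) (a : G) : TwistedGroupAlgebra ξ := basis ξ a

/-- The bilinear extension of `u_a u_b = ξ(a,b) u_{a+b}`. -/
def mulBilin (ξ : TwoCocycle G F) :
    TwistedGroupAlgebra ξ →ₗ[F] TwistedGroupAlgebra ξ →ₗ[F] TwistedGroupAlgebra ξ :=
  (basis ξ).constr F fun a => (basis ξ).constr F fun b => (ξ.toFun a b : F) • u ξ (a + b)

instance : Mul (TwistedGroupAlgebra ξ) := ⟨fun x y => mulBilin ξ x y⟩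

instance : One (TwistedGroupAlgebra ξ) := ⟨((ξ.toFun 0 0)⁻¹ : F) • u ξ 0⟩

theorem mul_eq (x y : TwistedGroupAlgebra ξ) : x * y = mulBilin ξ x y := rfl

theorem one_eq : (1 : TwistedGroupAlgebra ξ) = ((ξ.toFun 0 0)⁻¹ : F) • u ξ 0 := rfl

theorem mulBilin_u (a b : G) :
    mulBilin ξ (u ξ a) (u ξ b) = (ξ.toFun a b : F) • u ξ (a + b) := by
  unfold mulBilin u
  rw [Module.Basis.constr_basis, Module.Basis.constr_basis]

theorem u_mul_u (a b : G) : u ξ a * u ξ b = (ξ.toFun a b : F) • u ξ (a + b) := mulBilin_u a b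

theorem cocycle_zero_left (b : G) : ξ.toFun 0 b = ξ.toFun 0 0 := by
  have h := ξ.cocycle 0 0 b
  simp only [zero_add] at h
  exact (mul_right_cancel h).symm

theorem cocycle_zero_right (a : G) : ξ.toFun a 0 = ξ.toFun 0 0 := by
  have h := ξ.cocycle a 0 0
  simp only [add_zero] at h
  exact mul_right_cancel h

theorem induction_u {p : TwistedGroupAlgebra ξ → Prop} (hu : ∀ a, p (u ξ a)) (h0 : p 0)
    (hadd : ∀ x y, p x → p y → p (x + y)) (hsmul : ∀ (c : F) x, p x → p (c • x))
    (x : TwistedGroupAlgebra ξ) : p x := by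
  have hx : x ∈ Submodule.span F (Set.range (basis ξ)) := (basis ξ).mem_span x
  refine Submodule.span_induction (p := fun y _ => p y) ?_ h0 (fun y z _ _ hy hz => hadd y z hy hz)
    (fun c y _ hy => hsmul c y hy) hx
  rintro _ ⟨a, rfl⟩
  exact hu a

protected theorem mul_assoc' (x y z : TwistedGroupAlgebra ξ) :
    mulBilin ξ (mulBilin ξ x y) z = mulBilin ξ x (mulBilin ξ y z) := by
  induction x using induction_u with
  | h0 => simp
  | hadd x y hx hy => simp only [map_add, LinearMap.add_apply, hx, hy]
  | hsmul c x hx => simp only [map_smul, LinearMap.smul_apply, hx]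
  | hu a =>
  induction y using induction_u with
  | h0 => simp
  | hadd x y hx hy => simp only [map_add, LinearMap.add_apply, hx, hy]
  | hsmul c x hx => simp only [map_smul, LinearMap.smul_apply, hx]
  | hu b =>
  induction z using induction_u with
  | h0 => simp
  | hadd x y hx hy => simp only [map_add, hx, hy]
  | hsmul c x hx => simp only [map_smul, hx]
  | hu c =>
  have h : (ξ.toFun a b : F) * ξ.toFun (a + b) c = ξ.toFun b c * ξ.toFun a (b + c) := by
    exact_mod_cast congrArg Units.val (ξ.cocycle a b c)
  simp only [mulBilin_u, map_smul, LinearMap.smul_apply, smul_smul, h, add_assoc]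

instance : Ring (TwistedGroupAlgebra ξ) :=
  { (inferInstance : AddCommGroup (TwistedGroupAlgebra ξ)),
    (inferInstance : Mul (TwistedGroupAlgebra ξ)),
    (inferInstance : One (TwistedGroupAlgebra ξ)) with
    left_distrib := fun x y z => by simp only [mul_eq, map_add]
    right_distrib := fun x y z => by simp only [mul_eq, map_add, LinearMap.add_apply]
    zero_mul := fun x => by simp only [mul_eq, map_zero, LinearMap.zero_apply]
    mul_zero := fun x => by simp only [mul_eq, map_zero]
    mul_assoc := fun x y z => TwistedGroupAlgebra.mul_assoc' x y z
    one_mul := fun x => by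
      rw [mul_eq, one_eq]
      induction x using induction_u with
      | h0 => rw [map_zero]
      | hadd x y hx hy => rw [map_add, hx, hy]
      | hsmul c x hx => rw [map_smul, hx]
      | hu a =>
        rw [map_smul, LinearMap.smul_apply, mulBilin_u, smul_smul, cocycle_zero_left a,
          zero_add, inv_mul_cancel₀ (Units.ne_zero _), one_smul]
    mul_one := fun x => by
      rw [mul_eq, one_eq]
      induction x using induction_u with
      | h0 => rw [map_zero, LinearMap.zero_apply]
      | hadd x y hx hy => rw [map_add, LinearMap.add_apply, hx, hy]
      | hsmul c x hx => rw [LinearMap.map_smul₂, hx]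
      | hu a =>
        rw [map_smul, mulBilin_u, smul_smul, cocycle_zero_right a,
          add_zero, inv_mul_cancel₀ (Units.ne_zero _), one_smul]
    zsmul := fun n x => n • x
    zsmul_zero' := fun x => zero_smul ℤ x
    zsmul_succ' := fun n x => SubNegMonoid.zsmul_succ' n x
    zsmul_neg' := fun n x => SubNegMonoid.zsmul_neg' n x }

instance : Algebra F (TwistedGroupAlgebra ξ) :=
  Algebra.ofModule
    (fun c x y => by simp only [mul_eq, map_smul, LinearMap.smul_apply])
    (fun c x y => by simp only [mul_eq, map_smul])

end TwistedGroupAlgebra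

/-! ### Skew root systems -/

/-- `R` is a skew root system of Lie type in `(G, β)`. -/
structure IsSkewRootSystemLie {G F : Type*} [AddCommGroup G] [Field F] (β : AltBichar G F)
    (R : Set G) : Prop where
  nontrivial : β.rad ≠ Set.univ
  subset : R ⊆ (β.rad)ᶜ
  generates : AddSubgroup.closure R = ⊤
  neg_mem : ∀ a ∈ R, -a ∈ R
  add_mem : ∀ a ∈ R, ∀ b ∈ R, β.toFun a b ≠ 1 → a + b ∈ R

/-- `R` is a skew root system of Jordan type in `(G, β)`. -/
structure IsSkewRootSystemJordan {G F : Type*} [AddCommGroup G] [Field F] (β : AltBichar G F)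
    (R : Set G) : Prop where
  generates : AddSubgroup.closure R = ⊤
  neg_mem : ∀ a ∈ R, -a ∈ R
  add_mem : ∀ a ∈ R, ∀ b ∈ R, β.toFun a b ≠ -1 → a + b ∈ R

/-- `2` is invertible in every algebra over a field of characteristic zero. -/
abbrev invertibleTwo (F A : Type*) [Field F] [CharZero F] [Ring A] [Algebra F A] :
    Invertible (2 : A) where
  invOf := algebraMap F A (2⁻¹)
  invOf_mul_self := by
    rw [← map_ofNat (algebraMap F A) 2, ← map_mul, inv_mul_cancel₀ two_ne_zero, map_one]
  mul_invOf_self := by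
    rw [← map_ofNat (algebraMap F A) 2, ← map_mul, mul_inv_cancel₀ two_ne_zero, map_one]

instance {G F : Type*} [AddCommGroup G] [Field F] [CharZero F] {ξ : TwoCocycle G F} :
    Invertible (2 : TwistedGroupAlgebra ξ) := invertibleTwo F _

/-- The graded subspace `⨁_{a ∈ R} F u_a` of `F^ξ G`. -/
def rootSpan {G F : Type*} [AddCommGroup G] [Field F] (ξ : TwoCocycle G F) (R : Set G) :
    Submodule F (TwistedGroupAlgebra ξ) :=
  Submodule.span F (TwistedGroupAlgebra.u ξ '' R)

theorem rootSpan_lie_mem {G F : Type*} [AddCommGroup G] [Field F] {ξ : TwoCocycle G F}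
    {β : AltBichar G F} (hξ : ξ.CorrespondsTo β) {R : Set G} (hR : IsSkewRootSystemLie β R)
    {x y : TwistedGroupAlgebra ξ} (hx : x ∈ rootSpan ξ R) (hy : y ∈ rootSpan ξ R) :
    x * y - y * x ∈ rootSpan ξ R := by
  unfold rootSpan at hx hy
  induction hx, hy using Submodule.span_induction₂ with
  | mem_mem x y hx hy =>
    obtain ⟨a, ha, rfl⟩ := hx
    obtain ⟨b, hb, rfl⟩ := hy
    rw [TwistedGroupAlgebra.u_mul_u, TwistedGroupAlgebra.u_mul_u, add_comm b a, ← sub_smul]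
    by_cases h : β.toFun a b = 1
    · have h2 : ξ.toFun a b = ξ.toFun b a := by
        rw [← hξ a b] at h
        exact mul_inv_eq_one.mp h
      rw [h2, sub_self, zero_smul]
      exact zero_mem _
    · exact Submodule.smul_mem _ _ (Submodule.subset_span ⟨_, hR.add_mem a ha b hb h, rfl⟩)
  | zero_left => simp
  | zero_right => simp
  | add_left x y z _ _ _ h1 h2 =>
    have : (x + y) * z - z * (x + y) = (x * z - z * x) + (y * z - z * y) := by noncomm_ring
    rw [this]; exact add_mem h1 h2
  | add_right x y z _ _ _ h1 h2 =>
    have : x * (y + z) - (y + z) * x = (x * y - y * x) + (x * z - z * x) := by noncomm_ring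
    rw [this]; exact add_mem h1 h2
  | smul_left c x y _ _ h =>
    rw [smul_mul_assoc, mul_smul_comm, ← smul_sub]; exact Submodule.smul_mem _ _ h
  | smul_right c x y _ _ h =>
    rw [smul_mul_assoc, mul_smul_comm, ← smul_sub]; exact Submodule.smul_mem _ _ h

theorem rootSpan_jordan_mem {G F : Type*} [AddCommGroup G] [Field F] {ξ : TwoCocycle G F}
    {β : AltBichar G F} (hξ : ξ.CorrespondsTo β) {R : Set G} (hR : IsSkewRootSystemJordan β R)
    {x y : TwistedGroupAlgebra ξ} (hx : x ∈ rootSpan ξ R) (hy : y ∈ rootSpan ξ R) :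
    x * y + y * x ∈ rootSpan ξ R := by
  unfold rootSpan at hx hy
  induction hx, hy using Submodule.span_induction₂ with
  | mem_mem x y hx hy =>
    obtain ⟨a, ha, rfl⟩ := hx
    obtain ⟨b, hb, rfl⟩ := hy
    rw [TwistedGroupAlgebra.u_mul_u, TwistedGroupAlgebra.u_mul_u, add_comm b a, ← add_smul]
    by_cases h : β.toFun a b = -1
    · have h2 : ξ.toFun a b = -ξ.toFun b a := by
        rw [← hξ a b] at h
        rw [mul_inv_eq_iff_eq_mul.mp h, neg_one_mul]
      rw [h2, Units.val_neg, neg_add_cancel, zero_smul]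
      exact zero_mem _
    · exact Submodule.smul_mem _ _ (Submodule.subset_span ⟨_, hR.add_mem a ha b hb h, rfl⟩)
  | zero_left => simp
  | zero_right => simp
  | add_left x y z _ _ _ h1 h2 =>
    have : (x + y) * z + z * (x + y) = (x * z + z * x) + (y * z + z * y) := by noncomm_ring
    rw [this]; exact add_mem h1 h2
  | add_right x y z _ _ _ h1 h2 =>
    have : x * (y + z) + (y + z) * x = (x * y + y * x) + (x * z + z * x) := by noncomm_ring
    rw [this]; exact add_mem h1 h2
  | smul_left c x y _ _ h =>
    rw [smul_mul_assoc, mul_smul_comm, ← smul_add]; exact Submodule.smul_mem _ _ h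
  | smul_right c x y _ _ h =>
    rw [smul_mul_assoc, mul_smul_comm, ← smul_add]; exact Submodule.smul_mem _ _ h

/-- The Lie algebra `L(R) = ⨁_{a ∈ R} F u_a`, a Lie subalgebra of `F^ξ G` with the bracket
`[x, y] = x y - y x`. -/
def lieOfRoots {G F : Type*} [AddCommGroup G] [Field F] {ξ : TwoCocycle G F}
    {β : AltBichar G F} (hξ : ξ.CorrespondsTo β) {R : Set G} (hR : IsSkewRootSystemLie β R) :
    LieSubalgebra F (TwistedGroupAlgebra ξ) :=
  { rootSpan ξ R with
    lie_mem' := fun {x y} hx hy => by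
      rw [Ring.lie_def]
      exact rootSpan_lie_mem hξ hR hx hy }

/-- A subspace of an associative algebra `A` that is closed under `x y + y x`, as a Jordan
subalgebra of `A⁺`, i.e. of `A` with the product `x ∘ y = (x y + y x) / 2`. -/
def jordanSubalgebra {F A : Type*} [Field F] [CharZero F] [Ring A] [Algebra F A] [Invertible (2 : A)]
    (S : Submodule F A) (hS : ∀ x ∈ S, ∀ y ∈ S, x * y + y * x ∈ S) :
    NonUnitalSubalgebra F (SymAlg A) where
  carrier := {x | SymAlg.unsym x ∈ S}
  add_mem' := fun {x y} hx hy => S.add_mem hx hy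
  zero_mem' := S.zero_mem
  smul_mem' := fun c x hx => S.smul_mem c hx
  mul_mem' := fun {x y} hx hy => by
    have h2 := hS _ hx _ hy
    have h3 : SymAlg.unsym (x * y) = (2⁻¹ : F) • (SymAlg.unsym x * SymAlg.unsym y +
        SymAlg.unsym y * SymAlg.unsym x) := by
      have h4 : (⅟2 : A) = algebraMap F A 2⁻¹ := by
        refine invOf_eq_right_inv ?_
        rw [← map_ofNat (algebraMap F A) 2, ← map_mul, mul_inv_cancel₀ two_ne_zero, map_one]
      rw [SymAlg.unsym_mul, h4, Algebra.smul_def]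
    change SymAlg.unsym (x * y) ∈ S
    rw [h3]
    exact S.smul_mem _ h2

/-- The Jordan algebra `J(R) = ⨁_{a ∈ R} F u_a`, a Jordan subalgebra of `(F^ξ G)⁺`. -/
def jordanOfRoots {G F : Type*} [AddCommGroup G] [Field F] [CharZero F] {ξ : TwoCocycle G F}
    {β : AltBichar G F} (hξ : ξ.CorrespondsTo β) {R : Set G} (hR : IsSkewRootSystemJordan β R) :
    NonUnitalSubalgebra F (SymAlg (TwistedGroupAlgebra ξ)) :=
  jordanSubalgebra (rootSpan ξ R) fun _ hx _ hy => rootSpan_jordan_mem hξ hR hx hy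

/-! ### Algebras with involution -/

/-- An involution of an associative algebra: an involutive anti-automorphism. -/
structure Involution (F A : Type*) [Field F] [Ring A] [Algebra F A] where
  toLin : A →ₗ[F] A
  map_mul : ∀ x y, toLin (x * y) = toLin y * toLin x
  involutive : ∀ x, toLin (toLin x) = x

namespace Involution

variable {F A : Type*} [Field F] [Ring A] [Algebra F A]

/-- The subspace of the `x` with `x* = -x`. -/
def skewPart (σ : Involution F A) : Submodule F A where
  carrier := {x | σ.toLin x = -x}
  add_mem' := fun {x y} hx hy => by
    simp only [Set.mem_ofPred_eq] at hx hy ⊢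
    rw [map_add, hx, hy, neg_add]
  zero_mem' := by simp
  smul_mem' := fun c x hx => by
    simp only [Set.mem_ofPred_eq] at hx ⊢
    rw [map_smul, hx, smul_neg]

/-- The subspace of the `x` with `x* = x`. -/
def symPart (σ : Involution F A) : Submodule F A where
  carrier := {x | σ.toLin x = x}
  add_mem' := fun {x y} hx hy => by
    simp only [Set.mem_ofPred_eq] at hx hy ⊢
    rw [map_add, hx, hy]
  zero_mem' := by simp
  smul_mem' := fun c x hx => by
    simp only [Set.mem_ofPred_eq] at hx ⊢
    rw [map_smul, hx]

/-- The Lie algebra `K(A, *)`, with the bracket `[x, y] = x y - y x`. -/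
def K (σ : Involution F A) : LieSubalgebra F A :=
  { σ.skewPart with
    lie_mem' := fun {x y} hx hy => by
      have hx' : σ.toLin x = -x := hx
      have hy' : σ.toLin y = -y := hy
      change σ.toLin ⁅x, y⁆ = -⁅x, y⁆
      rw [Ring.lie_def, map_sub, σ.map_mul, σ.map_mul, hx', hy']
      noncomm_ring }

/-- The Jordan algebra `H(A, *)`, with the product `x ∘ y = (x y + y x) / 2`. -/
def H [CharZero F] [Invertible (2 : A)] (σ : Involution F A) : NonUnitalSubalgebra F (SymAlg A) :=
  jordanSubalgebra σ.symPart fun x hx y hy => by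
    have hx' : σ.toLin x = x := hx
    have hy' : σ.toLin y = y := hy
    change σ.toLin (x * y + y * x) = x * y + y * x
    rw [map_add, σ.map_mul, σ.map_mul, hx', hy', add_comm]

end Involution

instance {n F : Type*} [Fintype n] [DecidableEq n] [Field F] [CharZero F] :
    Invertible (2 : Matrix n n F) := invertibleTwo F _

/-- The involution `X ↦ Φ⁻¹ Xᵗ Φ` of a matrix algebra, i.e. the adjoint map of the nonsingular
symmetric or skew-symmetric bilinear form with matrix `Φ`. -/
def adjointInvolution {n F : Type*} [Fintype n] [DecidableEq n] [Field F] (Φ : Matrix n n F)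
    (hdet : IsUnit Φ.det) (hsym : Φ.transpose = Φ ∨ Φ.transpose = -Φ) :
    Involution F (Matrix n n F) where
  toLin :=
    { toFun := fun X => Φ⁻¹ * X.transpose * Φ
      map_add' := fun X Y => by
        rw [Matrix.transpose_add, Matrix.mul_add, Matrix.add_mul]
      map_smul' := fun c X => by simp }
  map_mul := fun X Y => by
    change Φ⁻¹ * (X * Y).transpose * Φ = Φ⁻¹ * Y.transpose * Φ * (Φ⁻¹ * X.transpose * Φ)
    have h : Φ * Φ⁻¹ = 1 := Matrix.mul_nonsing_inv Φ hdet
    calc Φ⁻¹ * (X * Y).transpose * Φ = Φ⁻¹ * Y.transpose * 1 * X.transpose * Φ := by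
          rw [Matrix.transpose_mul, Matrix.mul_one]; simp only [Matrix.mul_assoc]
      _ = _ := by rw [← h]; simp only [Matrix.mul_assoc]
  involutive := fun X => by
    change Φ⁻¹ * (Φ⁻¹ * X.transpose * Φ).transpose * Φ = X
    have h : Φ⁻¹ * Φ = 1 := Matrix.nonsing_inv_mul Φ hdet
    rw [Matrix.transpose_mul, Matrix.transpose_mul, Matrix.transpose_transpose,
      Matrix.transpose_nonsing_inv]
    rcases hsym with e | e
    · rw [e, ← Matrix.mul_assoc, h, Matrix.one_mul, Matrix.mul_assoc, h, Matrix.mul_one]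
    · have h2 : (-Φ)⁻¹ = -Φ⁻¹ :=
        Matrix.inv_eq_left_inv (by rw [Matrix.neg_mul, Matrix.mul_neg, neg_neg, h])
      rw [e, h2]
      simp only [Matrix.neg_mul, Matrix.mul_neg, neg_neg]
      rw [← Matrix.mul_assoc, h, Matrix.one_mul, Matrix.mul_assoc, h, Matrix.mul_one]

/-- The defining property of the adjoint: `φ(X u, v) = φ(u, X* v)` for `φ(u, v) = uᵗ Φ v`. -/
theorem adjointInvolution_spec {n F : Type*} [Fintype n] [DecidableEq n] [Field F]
    (Φ : Matrix n n F) (hdet : IsUnit Φ.det) (hsym : Φ.transpose = Φ ∨ Φ.transpose = -Φ)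
    (X : Matrix n n F) (u v : n → F) :
    Matrix.toBilin' Φ (X.mulVec u) v =
      Matrix.toBilin' Φ u (((adjointInvolution Φ hdet hsym).toLin X).mulVec v) := by
  change _ = Matrix.toBilin' Φ u ((Φ⁻¹ * X.transpose * Φ).mulVec v)
  rw [Matrix.toBilin'_apply', Matrix.toBilin'_apply', Matrix.mulVec_mulVec, Matrix.mul_assoc,
    ← Matrix.mul_assoc, Matrix.mul_nonsing_inv Φ hdet, Matrix.one_mul, ← Matrix.mulVec_mulVec,
    Matrix.dotProduct_mulVec u, Matrix.vecMul_transpose]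

/-- `H(F_n)`: the Jordan algebra of all symmetric matrices. -/
def jordanSymmetric (n F : Type*) [Fintype n] [DecidableEq n] [Field F] [CharZero F] :
    NonUnitalSubalgebra F (SymAlg (Matrix n n F)) :=
  (adjointInvolution (1 : Matrix n n F) (by simp) (Or.inl (by simp))).H

/-- `H(Q_{2l})`: the Jordan algebra of all matrices of size `2l` that are symmetric with respect
to the symplectic involution, the adjoint map of the canonical skew-symmetric form. -/
def jordanSymplectic (l F : Type*) [Fintype l] [DecidableEq l] [Field F] [CharZero F] :
    NonUnitalSubalgebra F (SymAlg (Matrix (l ⊕ l) (l ⊕ l) F)) :=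
  (adjointInvolution (Matrix.J l F) (Matrix.isUnit_det_J l F)
    (Or.inr (Matrix.J_transpose l F))).H

/-- Isomorphism of Jordan algebras. -/
def JordanIso {F A B : Type*} [Field F] [Ring A] [Algebra F A] [Invertible (2 : A)] [Ring B]
    [Algebra F B] [Invertible (2 : B)] (S : NonUnitalSubalgebra F (SymAlg A))
    (T : NonUnitalSubalgebra F (SymAlg B)) : Prop :=
  ∃ e : S ≃ₗ[F] T, ∀ x y : S, e (x * y) = e x * e y

/-! ### Tensor products of algebras with involution -/

/-- The tensor product `*₁ ⊗ ⋯ ⊗ *ₖ` of involutions. -/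
def tensorInvolution {ι F : Type*} {A : ι → Type*} [Field F] [∀ i, Ring (A i)]
    [∀ i, Algebra F (A i)] (σ : ∀ i, Involution F (A i)) :
    Involution F (PiTensorProduct F A) where
  toLin := PiTensorProduct.map fun i => (σ i).toLin
  map_mul := fun x y => by
    induction x using PiTensorProduct.induction_on with
    | add x x' hx hx' => rw [add_mul, map_add, hx, hx', map_add, mul_add]
    | smul_tprod r a =>
      induction y using PiTensorProduct.induction_on with
      | add y y' hy hy' => rw [mul_add, map_add, hy, hy', map_add, add_mul]
      | smul_tprod s b =>
        rw [PiTensorProduct.smul_tprod_mul_smul_tprod, map_smul, map_smul, map_smul,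
          PiTensorProduct.map_tprod, PiTensorProduct.map_tprod, PiTensorProduct.map_tprod,
          PiTensorProduct.smul_tprod_mul_smul_tprod, mul_comm s r]
        congr 2
        funext i
        exact (σ i).map_mul _ _
  involutive := fun x => by
    induction x using PiTensorProduct.induction_on with
    | add x x' hx hx' => rw [map_add, map_add, hx, hx']
    | smul_tprod r a =>
      rw [map_smul, map_smul, PiTensorProduct.map_tprod, PiTensorProduct.map_tprod]
      congr 2
      funext i
      exact (σ i).involutive _

/-! ### Gradings -/

/-- The subspaces `𝒜 a` form a `G`-grading of the algebra `A`. -/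
def IsGrading {G F A : Type*} [AddCommGroup G] [DecidableEq G] [Field F] [Ring A] [Algebra F A]
    (𝒜 : G → Submodule F A) : Prop :=
  DirectSum.IsInternal 𝒜 ∧ ∀ a b, ∀ x ∈ 𝒜 a, ∀ y ∈ 𝒜 b, x * y ∈ 𝒜 (a + b)

/-- The grading `𝒜` induces a grading of the subspace `S`, i.e. `S = ⨁ₐ S ∩ 𝒜 a`
(the sum is direct, as `𝒜` is a grading). -/
def IsGradedSubspace {G F A : Type*} [Field F] [Ring A] [Algebra F A]
    (𝒜 : G → Submodule F A) (S : Submodule F A) : Prop :=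
  S = ⨆ a, S ⊓ 𝒜 a

/-- The support of the grading of the subspace `S` that is induced by `𝒜`. -/
def gradedSupport {G F A : Type*} [Field F] [Ring A] [Algebra F A]
    (𝒜 : G → Submodule F A) (S : Submodule F A) : Set G :=
  {a | S ⊓ 𝒜 a ≠ ⊥}

/-! ### The group `ℤ₂^{2k}` and the forms on it -/

/-- `G = (ℤ₂ × ℤ₂)^k = ℤ₂^{2k}`; for `a : G`, the `i`-th pair `a i` (`i = 0, …, k - 1`) holds the
coordinates `a_{2i+1}, a_{2i+2}` of `a = (a_1, …, a_{2k})`. -/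
abbrev Grp (k : ℕ) : Type := Fin k → ZMod 2 × ZMod 2

/-- `f_0(a) = ∑ a_{2i-1} a_{2i}`. -/
def f0 {k : ℕ} (a : Grp k) : ZMod 2 := ∑ i, (a i).1 * (a i).2

/-- `f_1(a) = a_1² + a_2² + ∑ a_{2i-1} a_{2i}`. -/
def f1 {k : ℕ} [NeZero k] (a : Grp k) : ZMod 2 :=
  (a 0).1 ^ 2 + (a 0).2 ^ 2 + ∑ i, (a i).1 * (a i).2

/-- `R_0^- = {a ∈ G \ {0} | f_0(a) = 1}`. -/
def R0minus (k : ℕ) : Set (Grp k) := {a | a ≠ 0 ∧ f0 a = 1}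

/-- `R_0^+ = {a ∈ G | f_0(a) = 0}`. -/
def R0plus (k : ℕ) : Set (Grp k) := {a | f0 a = 0}

/-- `R_1^- = {a ∈ G \ {0} | f_1(a) = 1}`. -/
def R1minus (k : ℕ) [NeZero k] : Set (Grp k) := {a | a ≠ 0 ∧ f1 a = 1}

/-- `R_1^+ = {a ∈ G | f_1(a) = 0}`. -/
def R1plus (k : ℕ) [NeZero k] : Set (Grp k) := {a | f1 a = 0}

/-- `(-1)^x` for `x ∈ ℤ₂`. -/
def sgn (F : Type*) [Field F] (x : ZMod 2) : Fˣ := (-1) ^ x.val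

theorem sgn_add (F : Type*) [Field F] (x y : ZMod 2) : sgn F (x + y) = sgn F x * sgn F y := by
  have h : ∀ x y : ZMod 2, ((-1 : Fˣ)) ^ (x + y).val = (-1) ^ x.val * (-1) ^ y.val := by
    intro x y
    rw [← pow_add, ZMod.val_add]
    conv_rhs => rw [← Nat.mod_add_div (x.val + y.val) 2, pow_add, pow_mul, neg_one_sq, one_pow,
      mul_one]
  exact h x y

theorem sgn_zero (F : Type*) [Field F] : sgn F 0 = 1 := by simp [sgn]

/-- `β_1(a, b) = ∑ (a_{2i} b_{2i-1} - a_{2i-1} b_{2i})`. -/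
def beta1 {k : ℕ} (a b : Grp k) : ZMod 2 := ∑ i, ((a i).2 * (b i).1 - (a i).1 * (b i).2)

/-- `β(a, b) = (-1)^{β_1(a, b)}`. -/
def stdBichar (k : ℕ) (F : Type*) [Field F] : AltBichar (Grp k) F where
  toFun a b := sgn F (beta1 a b)
  map_add_left a b c := by
    rw [← sgn_add]
    congr 1
    simp only [beta1, ← Finset.sum_add_distrib, Pi.add_apply, Prod.fst_add, Prod.snd_add]
    exact Finset.sum_congr rfl fun i _ => by ring
  map_add_right a b c := by
    rw [← sgn_add]
    congr 1
    simp only [beta1, ← Finset.sum_add_distrib, Pi.add_apply, Prod.fst_add, Prod.snd_add]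
    exact Finset.sum_congr rfl fun i _ => by ring
  map_self a := by
    have : beta1 a a = 0 := Finset.sum_eq_zero fun i _ => by ring
    rw [this, sgn_zero]

/-- The cocycle `ξ(a, b) = (-1)^{∑ a_{2i} b_{2i-1}}`. -/
def stdCocycle (k : ℕ) (F : Type*) [Field F] : TwoCocycle (Grp k) F where
  toFun a b := sgn F (∑ i, (a i).2 * (b i).1)
  cocycle a b c := by
    rw [← sgn_add, ← sgn_add]
    congr 1
    simp only [← Finset.sum_add_distrib, Pi.add_apply, Prod.fst_add, Prod.snd_add]
    exact Finset.sum_congr rfl fun i _ => by ring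

theorem stdCocycle_correspondsTo (k : ℕ) (F : Type*) [Field F] :
    (stdCocycle k F).CorrespondsTo (stdBichar k F) := by
  intro a b
  rw [mul_inv_eq_iff_eq_mul]
  change sgn F _ = sgn F _ * sgn F _
  rw [← sgn_add]
  congr 1
  simp only [beta1, ← Finset.sum_add_distrib]
  exact Finset.sum_congr rfl fun i _ => by ring

/-! ### The graded matrix algebra `M(2, F)^{⊗ k}` and its involutions -/

/-- `X = diag(-1, 1)`. -/
def matX (F : Type*) [Field F] : Matrix (Fin 2) (Fin 2) F := !![-1, 0; 0, 1]

/-- The permutation matrix `Y`. -/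
def matY (F : Type*) [Field F] : Matrix (Fin 2) (Fin 2) F := !![0, 1; 1, 0]

/-- The matrix `Φ₁` of the skew-symmetric form on `F²`. -/
def matPhi1 (F : Type*) [Field F] : Matrix (Fin 2) (Fin 2) F := !![0, 1; -1, 0]

/-- `M = M(2, F) ⊗ ⋯ ⊗ M(2, F)` (`k` factors). -/
abbrev TensorMat (k : ℕ) (F : Type*) [Field F] : Type _ :=
  PiTensorProduct F fun _ : Fin k => Matrix (Fin 2) (Fin 2) F

instance {k : ℕ} {F : Type*} [Field F] [CharZero F] : Invertible (2 : TensorMat k F) :=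
  invertibleTwo F _

/-- `X^{a_1} Y^{a_2} ⊗ ⋯ ⊗ X^{a_{2k-1}} Y^{a_{2k}}`. -/
def homogeneous (k : ℕ) (F : Type*) [Field F] (a : Grp k) : TensorMat k F :=
  PiTensorProduct.tprod F fun i => matX F ^ (a i).1.val * matY F ^ (a i).2.val

/-- The component `M_a` of the direct product grading, `F X^{a_1} Y^{a_2} ⊗ ⋯`. -/
def component (k : ℕ) (F : Type*) [Field F] (a : Grp k) : Submodule F (TensorMat k F) :=
  Submodule.span F {homogeneous k F a}

/-- The involution of `M(2, F)` given by the symmetric form with matrix `I₂`. -/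
def symInvolution (F : Type*) [Field F] : Involution F (Matrix (Fin 2) (Fin 2) F) :=
  adjointInvolution 1 (by simp) (Or.inl (by simp))

/-- The involution of `M(2, F)` given by the skew-symmetric form with matrix `Φ₁`. -/
def skewInvolution (F : Type*) [Field F] : Involution F (Matrix (Fin 2) (Fin 2) F) :=
  adjointInvolution (matPhi1 F) (by simp [matPhi1, Matrix.det_fin_two])
    (Or.inr (by ext i j; fin_cases i <;> fin_cases j <;> simp [matPhi1]))

/-- The involution of `M` for which every `φ_i` has the matrix `I₂`. -/
def involution0 (k : ℕ) (F : Type*) [Field F] : Involution F (TensorMat k F) :=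
  tensorInvolution fun _ => symInvolution F

/-- The involution of `M` for which `φ_1` has the matrix `Φ₁` and `φ_i`, `i > 1`, has the
matrix `I₂`. -/
def involution1 (k : ℕ) [NeZero k] (F : Type*) [Field F] : Involution F (TensorMat k F) :=
  tensorInvolution fun i => if i = 0 then skewInvolution F else symInvolution F

/-- The Kronecker product `C_1 ⊗ ⋯ ⊗ C_k`, a matrix of size `2^k` whose rows and columns are
indexed by the standard basis of `(F²)^{⊗ k}`. -/
def kronecker {k : ℕ} {F : Type*} [Field F] (C : Fin k → Matrix (Fin 2) (Fin 2) F) :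
    Matrix (Fin k → Fin 2) (Fin k → Fin 2) F :=
  Matrix.of fun r c => ∏ i, C i (r i) (c i)

/-- The matrix of the form `φ = φ_1 ⊗ ⋯ ⊗ φ_k` on `(F²)^{⊗ k}` if every `φ_i` has the
matrix `I₂`. -/
def form0 (k : ℕ) (F : Type*) [Field F] : Matrix (Fin k → Fin 2) (Fin k → Fin 2) F :=
  kronecker fun _ => 1

/-- The matrix of the form `φ = φ_1 ⊗ ⋯ ⊗ φ_k` on `(F²)^{⊗ k}` if `φ_1` has the matrix `Φ₁` and
`φ_i`, `i > 1`, has the matrix `I₂`. -/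
def form1 (k : ℕ) [NeZero k] (F : Type*) [Field F] :
    Matrix (Fin k → Fin 2) (Fin k → Fin 2) F :=
  kronecker fun i => if i = 0 then matPhi1 F else 1

end

end SkewRoot

open SkewRoot

/-! Write `q` for either `f0` or `f1`. Both are quadratic forms over `ZMod 2` with polarization
`beta1`: `q (a + b) = q a + q b + beta1 a b`. On the other side, each involution acts on a
homogeneous element of degree `a` by the sign `(-1)^(q a)`. Everything rests on these two facts.

Since the homogeneous elements form a basis and 2 is invertible, the second fact shows that the
symmetric elements are spanned by the degrees with `q a = 0` and the skew elements by those with `q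
a = 1`. This gives the induced gradings and their supports (`symPart_eq_span`, `skewPart_eq_span`).
The first fact gives closure of the root systems under addition: in the Lie case the value at the
sum is 1 + 1 + 1 = 1, in the Jordan case 0 + 0 + 0 = 0.

Generation is where `2 ≤ k` matters. For one factor the only root in `R0minus` is (1,1), and `f1`
vanishes only at 0, so neither `R0minus` nor `R1plus` generates. With a second factor, the vector
(1,1) placed there shifts the value of `q` by 1 without changing the other factor.

The signs in products of monomials in `X` and `Y` are exactly the cocycle (`homogeneous_mul`), so
sending `u_a` to the homogeneous element of degree `a` is an algebra isomorphism `ψ`. It carries the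
spans of roots onto the skew and symmetric parts. Finally, the Kronecker product turns the tensor
involutions into adjoints for the forms 1 and, after reindexing, `-J`; as `-J` and `J` have the same
adjoint, so and sp and the two matrix Jordan algebras appear. -/

namespace SkewRoot

/-! ### The quadratic forms `f0`, `f1` and generation of the group by their level sets. -/

section Quadratic

variable {k : ℕ}

theorem Grp.neg_eq (a : Grp k) : -a = a := by
  funext i
  have h : ∀ x : ZMod 2 × ZMod 2, -x = x := by decide
  exact h (a i)

/-- A sum over the factors of an identity on one copy of the Klein four-group, where all 16 cases
are checked. The minus sign in `beta1` is harmless modulo 2. -/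
theorem f0_add (a b : Grp k) : f0 (a + b) = f0 a + f0 b + beta1 a b := by
  simp only [f0, beta1, ← Finset.sum_add_distrib]
  refine Finset.sum_congr rfl fun i _ => ?_
  have h : ∀ x y : ZMod 2 × ZMod 2, (x + y).1 * (x + y).2 =
    x.1 * x.2 + y.1 * y.2 + (x.2 * y.1 - x.1 * y.2) := by decide
  exact h (a i) (b i)

/-- Squaring is the identity on `ZMod 2`, so `f1` differs from `f0` by an additive function; hence
the two forms have the same polarization. -/
theorem f1_eq [NeZero k] (a : Grp k) : f1 a = (a 0).1 + (a 0).2 + f0 a := by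
  have h : ∀ x : ZMod 2, x ^ 2 = x := by decide
  simp only [f1, f0, h]

theorem f1_add [NeZero k] (a b : Grp k) : f1 (a + b) = f1 a + f1 b + beta1 a b := by
  simp only [f1_eq, f0_add, Pi.add_apply, Prod.fst_add, Prod.snd_add]
  ring

theorem f0_single (i : Fin k) (x : ZMod 2 × ZMod 2) :
    f0 (Pi.single i x : Grp k) = x.1 * x.2 := by
  rw [f0, Finset.sum_eq_single i]
  · simp
  · intro j _ hj
    simp [hj]
  · simp

theorem beta1_single (a : Grp k) (i : Fin k) (x : ZMod 2 × ZMod 2) :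
    beta1 a (Pi.single i x) = (a i).2 * x.1 - (a i).1 * x.2 := by
  rw [beta1, Finset.sum_eq_single i]
  · simp
  · intro j _ hj
    simp [hj]
  · simp

theorem f1_single_zero [NeZero k] (x : ZMod 2 × ZMod 2) :
    f1 (Pi.single 0 x : Grp k) = x.1 + x.2 + x.1 * x.2 := by
  simp [f1_eq, f0_single]

theorem f1_single_of_ne [NeZero k] {i : Fin k} (hi : i ≠ 0) (x : ZMod 2 × ZMod 2) :
    f1 (Pi.single i x : Grp k) = x.1 * x.2 := by
  simp [f1_eq, f0_single, hi.symm]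

/-- A subgroup of `G` that contains two generators of each factor `ℤ₂ × ℤ₂` is everything. -/
theorem Grp.eq_top_of_single_mem (H : AddSubgroup (Grp k))
    (h10 : ∀ i, (Pi.single i (1, 0) : Grp k) ∈ H) (h01 : ∀ i, (Pi.single i (0, 1) : Grp k) ∈ H) :
    H = ⊤ := by
  rw [eq_top_iff]
  intro a _
  induction a using Pi.single_induction with
  | zero => exact H.zero_mem
  | add f g hf hg => exact H.add_mem (hf trivial) (hg trivial)
  | single i m =>
    have h : ∀ x : ZMod 2 × ZMod 2,
        x = 0 ∨ x = (1, 0) ∨ x = (0, 1) ∨ x = (1, 0) + (0, 1) := by decide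
    rcases h m with rfl | rfl | rfl | rfl
    · simp
    · exact h10 i
    · exact h01 i
    · rw [Pi.single_add]
      exact H.add_mem (h10 i) (h01 i)

theorem eq_zero_of_add_identity {q : Grp k → ZMod 2}
    (hq : ∀ a b, q (a + b) = q a + q b + beta1 a b) : q 0 = 0 := by
  have h := hq 0 0
  have hb : beta1 (0 : Grp k) 0 = 0 := by simp [beta1]
  rw [hb, add_zero, add_zero] at h
  simpa using h

/-- A vector x in factor i with `f0` equal to 0 is a difference of two roots: (1,1) in another
factor j is a root, it is orthogonal to factor i, and adding it to x raises the value to 1. -/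
theorem closure_R0minus (hk : 2 ≤ k) : AddSubgroup.closure (R0minus k) = ⊤ := by
  have mem : ∀ a : Grp k, f0 a = 1 → a ∈ AddSubgroup.closure (R0minus k) := fun a ha =>
    AddSubgroup.subset_closure ⟨by rintro rfl; simp [f0] at ha, ha⟩
  have key : ∀ (i : Fin k) (x : ZMod 2 × ZMod 2), x.1 * x.2 = 0 →
      (Pi.single i x : Grp k) ∈ AddSubgroup.closure (R0minus k) := by
    intro i x hx
    have : Nontrivial (Fin k) := Fin.nontrivial_iff_two_le.mpr hk
    obtain ⟨j, hj⟩ := exists_ne i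
    have h1 : (Pi.single j (1, 1) : Grp k) ∈ AddSubgroup.closure (R0minus k) :=
      mem _ (by rw [f0_single]; rfl)
    have h2 : (Pi.single i x + Pi.single j (1, 1) : Grp k) ∈
        AddSubgroup.closure (R0minus k) := by
      refine mem _ ?_
      rw [f0_add, f0_single, f0_single, beta1_single, hx]
      simp [hj]
    simpa using AddSubgroup.sub_mem _ h2 h1
  exact Grp.eq_top_of_single_mem _ (fun i => key i _ (by simp)) fun i => key i _ (by simp)

theorem closure_R0plus : AddSubgroup.closure (R0plus k) = ⊤ :=
  Grp.eq_top_of_single_mem _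
    (fun i => AddSubgroup.subset_closure (by simp [R0plus, f0_single]))
    fun i => AddSubgroup.subset_closure (by simp [R0plus, f0_single])

/-- Every nonzero vector of factor 0 is a root. In another factor, (1,0) and (0,1) have value 0 and
become roots after adding (1,0) in factor 0. -/
theorem closure_R1minus [NeZero k] : AddSubgroup.closure (R1minus k) = ⊤ := by
  have mem : ∀ a : Grp k, f1 a = 1 → a ∈ AddSubgroup.closure (R1minus k) := fun a ha =>
    AddSubgroup.subset_closure ⟨by rintro rfl; simp [f1] at ha, ha⟩
  have h0 : (Pi.single 0 (1, 0) : Grp k) ∈ AddSubgroup.closure (R1minus k) :=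
    mem _ (by simp [f1_single_zero])
  have key : ∀ (i : Fin k) (x : ZMod 2 × ZMod 2), x.1 * x.2 = 0 → x.1 + x.2 = 1 →
      (Pi.single i x : Grp k) ∈ AddSubgroup.closure (R1minus k) := by
    intro i x hx hx'
    by_cases hi : i = 0
    · subst hi
      exact mem _ (by rw [f1_single_zero, hx, hx', add_zero])
    · have h2 : (Pi.single i x + Pi.single (0 : Fin k) (1, 0) : Grp k) ∈
          AddSubgroup.closure (R1minus k) := by
        refine mem _ ?_
        rw [f1_add, f1_single_of_ne hi, f1_single_zero, beta1_single, hx]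
        simp [Ne.symm hi]
      simpa using AddSubgroup.sub_mem _ h2 h0
  exact Grp.eq_top_of_single_mem _ (fun i => key i _ (by simp) (by simp))
    fun i => key i _ (by simp) (by simp)

/-- Outside factor 0 the unit vectors already lie in `R1plus`. In factor 0 all nonzero vectors have
value 1, so a vector of value 1 from another factor must compensate. -/
theorem closure_R1plus [NeZero k] (hk : 2 ≤ k) : AddSubgroup.closure (R1plus k) = ⊤ := by
  have mem : ∀ a : Grp k, f1 a = 0 → a ∈ AddSubgroup.closure (R1plus k) := fun a ha =>
    AddSubgroup.subset_closure ha
  have hne : ∀ (i : Fin k) (x : ZMod 2 × ZMod 2), i ≠ 0 → x.1 * x.2 = 0 →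
      (Pi.single i x : Grp k) ∈ AddSubgroup.closure (R1plus k) := fun i x hi hx =>
    mem _ (by rw [f1_single_of_ne hi, hx])
  have key : ∀ (i : Fin k) (x : ZMod 2 × ZMod 2), x.1 * x.2 = 0 → x.1 + x.2 = 1 →
      (Pi.single i x : Grp k) ∈ AddSubgroup.closure (R1plus k) := by
    intro i x hx hx'
    by_cases hi : i = 0
    · subst hi
      have : Nontrivial (Fin k) := Fin.nontrivial_iff_two_le.mpr hk
      obtain ⟨j, hj⟩ := exists_ne (0 : Fin k)
      -- The vector (1,1) in factor j has value 1, so it is not itself a root, but it is a sum of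
      -- two roots.
      have h1 : (Pi.single j (1, 1) : Grp k) ∈ AddSubgroup.closure (R1plus k) := by
        have : ((1, 1) : ZMod 2 × ZMod 2) = (1, 0) + (0, 1) := by decide
        rw [this, Pi.single_add]
        exact AddSubgroup.add_mem _ (hne j _ hj (by simp)) (hne j _ hj (by simp))
      have h2 : (Pi.single (0 : Fin k) x + Pi.single j (1, 1) : Grp k) ∈
          AddSubgroup.closure (R1plus k) := by
        refine mem _ ?_
        rw [f1_add, f1_single_of_ne hj, f1_single_zero, beta1_single, hx, hx']
        simp only [Pi.single_eq_of_ne hj]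
        decide
      simpa using AddSubgroup.sub_mem _ h2 h1
    · exact hne i x hi hx
  exact Grp.eq_top_of_single_mem _ (fun i => key i _ (by simp) (by simp))
    fun i => key i _ (by simp) (by simp)

/-! ### Signs, nonsingularity of the bicharacter, and the root system axioms. -/

variable {F : Type*} [Field F]

theorem zmod_two_eq_zero_or_one (x : ZMod 2) : x = 0 ∨ x = 1 := by
  revert x
  decide

theorem sgn_one : sgn F 1 = -1 := by simp [sgn, ZMod.val_one]

section CharZero

variable [CharZero F]

theorem sgn_eq_one_iff {x : ZMod 2} : sgn F x = 1 ↔ x = 0 := by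
  rcases zmod_two_eq_zero_or_one x with rfl | rfl
  · simp [sgn_zero]
  · have h : (-1 : Fˣ) ≠ 1 := fun h => by
      have := congrArg Units.val h
      simp only [Units.val_neg, Units.val_one] at this
      norm_num at this
    simp [sgn_one, h]

theorem sgn_eq_neg_one_iff {x : ZMod 2} : sgn F x = -1 ↔ x = 1 := by
  rcases zmod_two_eq_zero_or_one x with rfl | rfl
  · have h : (1 : Fˣ) ≠ -1 := fun h => by
      have := congrArg Units.val h
      simp only [Units.val_neg, Units.val_one] at this
      norm_num at this
    simp [sgn_zero, h]
  · simp [sgn_one]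

/-- Pairing with (1,0) and (0,1) in factor i reads off the two coordinates of g there. -/
theorem stdBichar_nonsingular (k : ℕ) (F : Type*) [Field F] [CharZero F] :
    (stdBichar k F).Nonsingular := by
  ext g
  simp only [AltBichar.rad, Set.mem_ofPred_eq, Set.mem_singleton_iff]
  constructor
  · intro h
    funext i
    have h1 := sgn_eq_one_iff.mp (h (Pi.single i (1, 0)))
    have h2 := sgn_eq_one_iff.mp (h (Pi.single i (0, 1)))
    rw [beta1_single] at h1 h2
    refine Prod.ext ?_ ?_
    · simpa using h2
    · simpa using h1
  · rintro rfl b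
    exact sgn_eq_one_iff.mpr (by simp [beta1])

/-- Non-commuting means `beta1 a b = 1`, and then the polarization identity gives 1 + 1 + 1 = 1. The
sum is nonzero because `q 0 = 0`. -/
theorem isSkewRootSystemLie_of_quadratic [NeZero k] {q : Grp k → ZMod 2}
    (hq : ∀ a b, q (a + b) = q a + q b + beta1 a b)
    (hgen : AddSubgroup.closure {a | a ≠ 0 ∧ q a = 1} = ⊤) :
    IsSkewRootSystemLie (stdBichar k F) {a | a ≠ 0 ∧ q a = 1} where
  nontrivial := by
    rw [stdBichar_nonsingular k F]
    intro h
    have : (fun _ => (1, 0) : Grp k) ∈ ({0} : Set (Grp k)) := h ▸ Set.mem_univ _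
    have h0 := congrFun (Set.mem_singleton_iff.mp this) 0
    exact one_ne_zero (congrArg Prod.fst h0)
  subset := by
    rw [stdBichar_nonsingular k F]
    exact fun a ha => ha.1
  generates := hgen
  neg_mem a ha := by rwa [Grp.neg_eq]
  add_mem a ha b hb h := by
    have h1 : beta1 a b = 1 :=
      (zmod_two_eq_zero_or_one _).resolve_left fun h0 => h (sgn_eq_one_iff.mpr h0)
    have h2 : q (a + b) = 1 := by
      rw [hq, ha.2, hb.2, h1]
      decide
    refine ⟨fun h0 => ?_, h2⟩
    rw [h0, eq_zero_of_add_identity hq] at h2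
    exact absurd h2 (by decide)

theorem isSkewRootSystemJordan_of_quadratic {q : Grp k → ZMod 2}
    (hq : ∀ a b, q (a + b) = q a + q b + beta1 a b)
    (hgen : AddSubgroup.closure {a | q a = 0} = ⊤) :
    IsSkewRootSystemJordan (stdBichar k F) {a | q a = 0} where
  generates := hgen
  neg_mem a ha := by rwa [Grp.neg_eq]
  add_mem a ha b hb h := by
    have h1 : beta1 a b = 0 :=
      (zmod_two_eq_zero_or_one _).resolve_right fun h0 => h (sgn_eq_neg_one_iff.mpr h0)
    change q (a + b) = 0
    rw [hq, h1, show q a = 0 from ha, show q b = 0 from hb]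
    decide

end CharZero

end Quadratic

/-! ### Involutions that are diagonal in a basis -/

section Diagonal

variable {G F A : Type*} [Field F] [Ring A] [Algebra F A]

theorem span_image_inf_span_singleton_ne_bot_iff (b : Module.Basis G F A) (R : Set G) (a : G) :
    Submodule.span F (b '' R) ⊓ Submodule.span F {b a} ≠ ⊥ ↔ a ∈ R := by
  constructor
  · intro h
    obtain ⟨x, ⟨hx, hxa⟩, hx0⟩ := Submodule.exists_mem_ne_zero_of_ne_bot h
    obtain ⟨c, rfl⟩ := Submodule.mem_span_singleton.mp hxa
    have hc : c ≠ 0 := fun hc => hx0 (by rw [hc, zero_smul])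
    refine b.mem_span_image.mp hx ?_
    simp [hc]
  · intro ha h
    have : b a ∈ Submodule.span F (b '' R) ⊓ Submodule.span F {b a} :=
      ⟨Submodule.subset_span ⟨a, ha, rfl⟩, Submodule.mem_span_singleton_self _⟩
    rw [h] at this
    exact b.ne_zero a ((Submodule.mem_bot F).mp this)

theorem gradedSupport_span_image (b : Module.Basis G F A) (R : Set G) :
    gradedSupport (fun a => Submodule.span F {b a}) (Submodule.span F (b '' R)) = R :=
  Set.ext fun a => span_image_inf_span_singleton_ne_bot_iff b R a

theorem isGradedSubspace_span_image (b : Module.Basis G F A) (R : Set G) :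
    IsGradedSubspace (fun a => Submodule.span F {b a}) (Submodule.span F (b '' R)) := by
  refine le_antisymm (Submodule.span_le.mpr ?_) (iSup_le fun a => inf_le_left)
  rintro _ ⟨a, ha, rfl⟩
  exact Submodule.mem_iSup_of_mem a
    ⟨Submodule.subset_span ⟨a, ha, rfl⟩, Submodule.mem_span_singleton_self _⟩

theorem isInternal_span_singleton [DecidableEq G] (b : Module.Basis G F A) :
    DirectSum.IsInternal fun a => Submodule.span F {b a} :=
  DirectSum.isInternal_submodule_of_iSupIndep_of_iSup_eq_top
    b.linearIndependent.iSupIndep_span_singleton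
    (by rw [← Submodule.span_range_eq_iSup, b.span_eq])

variable {b : Module.Basis G F A} {σ : Involution F A} {q : G → ZMod 2}
  (hσ : ∀ a, σ.toLin (b a) = (sgn F (q a) : F) • b a)

include hσ

/-- Turns the eigenvalue equation for `σ` into one scalar equation per coordinate; both sides are
linear in `x`, so basis vectors suffice. -/
theorem repr_involution (x : A) (a : G) : b.repr (σ.toLin x) a = sgn F (q a) * b.repr x a := by
  have h : (Finsupp.lapply a ∘ₗ b.repr.toLinearMap) ∘ₗ σ.toLin =
      (sgn F (q a) : F) • (Finsupp.lapply a ∘ₗ b.repr.toLinearMap) := by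
    refine b.ext fun c => ?_
    simp only [LinearMap.comp_apply, hσ, LinearMap.smul_apply, map_smul, LinearEquiv.coe_coe,
      Module.Basis.repr_self, Finsupp.lapply_apply, smul_eq_mul]
    by_cases hc : c = a
    · rw [hc]
    · simp [Finsupp.single_eq_of_ne (Ne.symm hc)]
  exact LinearMap.congr_fun h x

theorem map_span_singleton_eq (a : G) :
    (Submodule.span F {b a}).map σ.toLin = Submodule.span F {b a} := by
  rw [Submodule.map_span, Set.image_singleton, hσ]
  exact Submodule.span_singleton_smul_eq (Units.isUnit _) _

variable [CharZero F]

/-- The equation at coordinate `a` is void if `q a = 0`; if `q a = 1` it says that the coordinate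
equals its negative, so it vanishes in characteristic 0. The skew case exchanges the two roles. -/
theorem symPart_eq_span : σ.symPart = Submodule.span F (b '' {a | q a = 0}) := by
  ext x
  rw [b.mem_span_image]
  change σ.toLin x = x ↔ _
  rw [← b.repr.injective.eq_iff, Finsupp.ext_iff]
  simp only [repr_involution hσ, Set.subset_def, Finset.mem_coe, Finsupp.mem_support_iff,
    Set.mem_ofPred_eq]
  refine forall_congr' fun a => ?_
  rcases zmod_two_eq_zero_or_one (q a) with h | h
  · simp [h, sgn_zero]
  · simp [h, sgn_one, neg_eq_self]

theorem skewPart_eq_span : σ.skewPart = Submodule.span F (b '' {a | q a = 1}) := by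
  ext x
  rw [b.mem_span_image]
  change σ.toLin x = -x ↔ _
  rw [← b.repr.injective.eq_iff, Finsupp.ext_iff]
  simp only [repr_involution hσ, Set.subset_def, Finset.mem_coe, Finsupp.mem_support_iff,
    Set.mem_ofPred_eq, map_neg, Finsupp.neg_apply]
  refine forall_congr' fun a => ?_
  rcases zmod_two_eq_zero_or_one (q a) with h | h
  · simp [h, sgn_zero, self_eq_neg]
  · simp [h, sgn_one]

end Diagonal

/-! ### Restricting algebra isomorphisms to Lie and Jordan subalgebras -/

section Restrict

variable {F A B : Type*} [Field F] [Ring A] [Algebra F A] [Ring B] [Algebra F B]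

theorem exists_lieEquiv_of_map_eq (e : A ≃ₐ[F] B) (L : LieSubalgebra F A) (L' : LieSubalgebra F B)
    (h : L.toSubmodule.map e.toLinearMap = L'.toSubmodule) :
    ∃ f : L ≃ₗ⁅F⁆ L', ∀ x, (f x : B) = e x := by
  refine ⟨LieEquiv.ofSubalgebras L L' e.toLieEquiv ?_, fun x => rfl⟩
  rw [← LieSubalgebra.toSubmodule_inj]
  exact h

theorem exists_jordanEquiv_of_map_eq [CharZero F] [Invertible (2 : A)] [Invertible (2 : B)]
    (e : A ≃ₐ[F] B) {S : Submodule F A} (hS : ∀ x ∈ S, ∀ y ∈ S, x * y + y * x ∈ S)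
    {T : Submodule F B} (hT : ∀ x ∈ T, ∀ y ∈ T, x * y + y * x ∈ T)
    (h : S.map e.toLinearMap = T) :
    ∃ f : jordanSubalgebra S hS ≃ₗ[F] jordanSubalgebra T hT,
      (∀ x y, f (x * y) = f x * f y) ∧
      ∀ x, SymAlg.unsym (f x : SymAlg B) = e (SymAlg.unsym x.1) := by
  -- A Jordan subalgebra has the same vectors as the subspace it comes from, so the restriction of
  -- `e` to the subspaces is wrapped in `sym` and `unsym`.
  let g : S ≃ₗ[F] T := LinearEquiv.ofSubmodules e.toLinearEquiv S T h
  let f : jordanSubalgebra S hS ≃ₗ[F] jordanSubalgebra T hT :=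
    { toFun := fun x => ⟨SymAlg.sym (g ⟨SymAlg.unsym x.1, x.2⟩), (g ⟨SymAlg.unsym x.1, x.2⟩).2⟩
      invFun := fun x => ⟨SymAlg.sym (g.symm ⟨SymAlg.unsym x.1, x.2⟩),
        (g.symm ⟨SymAlg.unsym x.1, x.2⟩).2⟩
      left_inv := fun x => Subtype.ext
        (congrArg (fun z : S => SymAlg.sym z.1) (g.symm_apply_apply ⟨SymAlg.unsym x.1, x.2⟩))
      right_inv := fun x => Subtype.ext
        (congrArg (fun z : T => SymAlg.sym z.1) (g.apply_symm_apply ⟨SymAlg.unsym x.1, x.2⟩))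
      map_add' := fun x y => Subtype.ext (congrArg (fun z : T => SymAlg.sym z.1)
        (g.map_add ⟨SymAlg.unsym x.1, x.2⟩ ⟨SymAlg.unsym y.1, y.2⟩))
      map_smul' := fun c x => Subtype.ext (congrArg (fun z : T => SymAlg.sym z.1)
        (g.map_smul c ⟨SymAlg.unsym x.1, x.2⟩)) }
  have hf : ∀ x, SymAlg.unsym (f x : SymAlg B) = e (SymAlg.unsym x.1) := fun x => rfl
  refine ⟨f, fun x y => Subtype.ext (SymAlg.unsym_injective ?_), hf⟩
  -- The halves in the two Jordan products come from unrelated `Invertible` instances; uniqueness of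
  -- inverses matches them.
  have h2 : e (⅟2) = ⅟2 := by
    refine (invOf_eq_right_inv ?_).symm
    rw [← map_ofNat e 2, ← map_mul, mul_invOf_self, map_one]
  rw [hf]
  change e (SymAlg.unsym (x.1 * y.1)) = SymAlg.unsym ((f x).1 * (f y).1)
  rw [SymAlg.unsym_mul, SymAlg.unsym_mul, hf, hf, map_mul, map_add, map_mul, map_mul, h2]

variable {σ : Involution F A} {τ : Involution F B} {e : A ≃ₐ[F] B}
  (h : ∀ x, e (σ.toLin x) = τ.toLin (e x))

include h

theorem map_skewPart : σ.skewPart.map e.toLinearMap = τ.skewPart := by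
  ext y
  constructor
  · rintro ⟨x, hx, rfl⟩
    change τ.toLin (e x) = -e x
    rw [← h, show σ.toLin x = -x from hx, map_neg]
  · intro hy
    refine ⟨e.symm y, e.injective ?_, e.apply_symm_apply y⟩
    rw [h, map_neg, e.apply_symm_apply]
    exact hy

theorem map_symPart : σ.symPart.map e.toLinearMap = τ.symPart := by
  ext y
  constructor
  · rintro ⟨x, hx, rfl⟩
    change τ.toLin (e x) = e x
    rw [← h, show σ.toLin x = x from hx]
  · intro hy
    refine ⟨e.symm y, e.injective ?_, e.apply_symm_apply y⟩
    rw [h, e.apply_symm_apply]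
    exact hy

theorem nonempty_K_lieEquiv : Nonempty (σ.K ≃ₗ⁅F⁆ τ.K) :=
  let ⟨f, _⟩ := exists_lieEquiv_of_map_eq e σ.K τ.K (map_skewPart h)
  ⟨f⟩

theorem jordanIso_H [CharZero F] [Invertible (2 : A)] [Invertible (2 : B)] :
    JordanIso σ.H τ.H :=
  let ⟨f, hf, _⟩ := exists_jordanEquiv_of_map_eq e _ _ (map_symPart h)
  ⟨f, hf⟩

end Restrict

/-- Multiplying the skewness equation on the left by `Φ` gives the skew-adjointness condition by
which so (for `Φ = 1`) and sp (for `Φ = J`) are defined. -/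
theorem adjointInvolution_K_eq {n F : Type*} [Fintype n] [DecidableEq n] [Field F]
    (Φ : Matrix n n F) (hdet : IsUnit Φ.det) (hsym : Φ.transpose = Φ ∨ Φ.transpose = -Φ) :
    (adjointInvolution Φ hdet hsym).K = skewAdjointMatricesLieSubalgebra Φ := by
  ext X
  rw [mem_skewAdjointMatricesLieSubalgebra, mem_skewAdjointMatricesSubmodule]
  change Φ⁻¹ * X.transpose * Φ = -X ↔ X.transpose * Φ = Φ * -X
  rw [Matrix.mul_assoc]
  constructor
  · intro h
    rw [← h, ← Matrix.mul_assoc, Matrix.mul_nonsing_inv Φ hdet, Matrix.one_mul]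
  · intro h
    rw [h, ← Matrix.mul_assoc, Matrix.nonsing_inv_mul Φ hdet, Matrix.one_mul]

noncomputable section

/-! ### Monomials in `X` and `Y` -/

section Monomials

theorem transpose_fin_two {α : Type*} (a b c d : α) :
    (!![a, b; c, d] : Matrix (Fin 2) (Fin 2) α).transpose = !![a, c; b, d] :=
  Matrix.eta_fin_two _

/-- `X^{x_1} Y^{x_2}`. -/
def monomialXY (F : Type*) [Field F] (x : ZMod 2 × ZMod 2) : Matrix (Fin 2) (Fin 2) F :=
  matX F ^ x.1.val * matY F ^ x.2.val

variable {F : Type*} [Field F]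

theorem zmod_two_prod_cases {p : ZMod 2 × ZMod 2 → Prop} (h00 : p (0, 0)) (h01 : p (0, 1))
    (h10 : p (1, 0)) (h11 : p (1, 1)) (x : ZMod 2 × ZMod 2) : p x := by
  have h : ∀ x : ZMod 2 × ZMod 2, x = (0, 0) ∨ x = (0, 1) ∨ x = (1, 0) ∨ x = (1, 1) := by decide
  rcases h x with rfl | rfl | rfl | rfl <;> assumption

theorem monomialXY_zero_zero : monomialXY F (0, 0) = !![1, 0; 0, 1] := by
  simp [monomialXY, Matrix.one_fin_two]

theorem monomialXY_zero_one : monomialXY F (0, 1) = !![0, 1; 1, 0] := by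
  simp [monomialXY, matY, ZMod.val_one]

theorem monomialXY_one_zero : monomialXY F (1, 0) = !![-1, 0; 0, 1] := by
  simp [monomialXY, matX, ZMod.val_one]

theorem monomialXY_one_one : monomialXY F (1, 1) = !![0, -1; 1, 0] := by
  simp [monomialXY, matX, matY, ZMod.val_one]

/-- `X` and `Y` are anticommuting square roots of 1; the sign comes from moving the `Y`-power of the
first monomial past the `X`-power of the second. -/
theorem monomialXY_mul (x y : ZMod 2 × ZMod 2) :
    monomialXY F x * monomialXY F y = (sgn F (x.2 * y.1) : F) • monomialXY F (x + y) := by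
  have h2 : (1 + 1 : ZMod 2) = 0 := by decide
  induction x using zmod_two_prod_cases <;> induction y using zmod_two_prod_cases <;>
    simp [monomialXY_zero_zero, monomialXY_zero_one, monomialXY_one_zero, monomialXY_one_one,
      sgn_zero, sgn_one, h2]

/-- Among 1, `X`, `Y`, `XY` only `XY` is skew under transposition. -/
theorem symInvolution_monomialXY (x : ZMod 2 × ZMod 2) :
    (symInvolution F).toLin (monomialXY F x) = (sgn F (x.1 * x.2) : F) • monomialXY F x := by
  change (1 : Matrix (Fin 2) (Fin 2) F)⁻¹ * (monomialXY F x).transpose * 1 = _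
  induction x using zmod_two_prod_cases <;>
    simp [monomialXY_zero_zero, monomialXY_zero_one, monomialXY_one_zero, monomialXY_one_one,
      sgn_zero, sgn_one, transpose_fin_two]

theorem matPhi1_inv : (matPhi1 F)⁻¹ = !![0, -1; 1, 0] := by
  refine Matrix.inv_eq_left_inv ?_
  simp [matPhi1, Matrix.one_fin_two]

/-- `Φ₁ = -XY`, so this involution is transposition followed by conjugation by `XY`. The conjugation
negates `X` and `Y` and fixes 1 and `XY`, so all three nontrivial monomials become skew. -/
theorem skewInvolution_monomialXY (x : ZMod 2 × ZMod 2) :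
    (skewInvolution F).toLin (monomialXY F x) =
      (sgn F (x.1 + x.2 + x.1 * x.2) : F) • monomialXY F x := by
  have h3 : (1 + 1 + 1 : ZMod 2) = 1 := by decide
  change (matPhi1 F)⁻¹ * (monomialXY F x).transpose * matPhi1 F = _
  rw [matPhi1_inv]
  induction x using zmod_two_prod_cases <;>
    simp [monomialXY_zero_zero, monomialXY_zero_one, monomialXY_one_zero, monomialXY_one_one,
      sgn_zero, sgn_one, h3, matPhi1, transpose_fin_two]

variable [CharZero F]

theorem linearIndependent_monomialXY (F : Type*) [Field F] [CharZero F] :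
    LinearIndependent F (monomialXY F) := by
  rw [Fintype.linearIndependent_iff]
  intro g hg
  -- `ZMod 2` unfolds to `Fin 2`, which makes the lemma about `Fin` apply.
  have hsum : ∀ h : ZMod 2 → Matrix (Fin 2) (Fin 2) F, ∑ i, h i = h 0 + h 1 := fun h =>
    Fin.sum_univ_two h
  rw [Fintype.sum_prod_type] at hg
  simp only [hsum, monomialXY_zero_zero, monomialXY_zero_one, monomialXY_one_zero,
    monomialXY_one_one] at hg
  have e00 := congrFun (congrFun hg 0) 0
  have e01 := congrFun (congrFun hg 0) 1
  have e10 := congrFun (congrFun hg 1) 0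
  have e11 := congrFun (congrFun hg 1) 1
  simp at e00 e01 e10 e11
  -- 1 and `X` fill the diagonal, `Y` and `XY` the antidiagonal; sums and differences of the entries
  -- isolate twice each coefficient.
  have cancel : ∀ z : F, 2 * z = 0 → z = 0 := fun z hz =>
    (mul_eq_zero.mp hz).resolve_left two_ne_zero
  refine zmod_two_prod_cases (cancel _ ?_) (cancel _ ?_) (cancel _ ?_) (cancel _ ?_)
  · linear_combination e00 + e11
  · linear_combination e01 + e10
  · linear_combination e11 - e00
  · linear_combination e10 - e01

/-- The basis of the monomials `X^{x_1} Y^{x_2}`. -/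
def monomialBasis (F : Type*) [Field F] [CharZero F] :
    Module.Basis (ZMod 2 × ZMod 2) F (Matrix (Fin 2) (Fin 2) F) :=
  basisOfLinearIndependentOfCardEqFinrank (linearIndependent_monomialXY F) (by
    simp [Module.finrank_matrix])

theorem monomialBasis_apply (x : ZMod 2 × ZMod 2) : monomialBasis F x = monomialXY F x := by
  simp [monomialBasis]

/-- The basis of the homogeneous elements `X^{a_1} Y^{a_2} ⊗ ⋯ ⊗ X^{a_{2k-1}} Y^{a_{2k}}`. -/
def homogeneousBasis (k : ℕ) (F : Type*) [Field F] [CharZero F] :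
    Module.Basis (Grp k) F (TensorMat k F) :=
  Basis.piTensorProduct fun _ => monomialBasis F

theorem homogeneousBasis_apply {k : ℕ} (a : Grp k) :
    homogeneousBasis k F a = homogeneous k F a := by
  rw [homogeneousBasis, Basis.piTensorProduct_apply]
  simp only [monomialBasis_apply]
  rfl

end Monomials

/-! ### Products of homogeneous elements and the signs of the involutions on them. -/

section Homogeneous

variable {F : Type*} [Field F]

theorem prod_sgn {ι : Type*} (s : Finset ι) (x : ι → ZMod 2) :
    ∏ i ∈ s, (sgn F (x i) : F) = sgn F (∑ i ∈ s, x i) := by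
  classical
  induction s using Finset.induction_on with
  | empty => simp [sgn_zero]
  | insert i s hi ih => rw [Finset.prod_insert hi, Finset.sum_insert hi, sgn_add, ih, Units.val_mul]

instance (k : ℕ) (F : Type*) [Field F] :
    IsScalarTower F (TensorMat k F) (TensorMat k F) :=
  ⟨fun c x y => Algebra.smul_mul_assoc c x y⟩

instance (k : ℕ) (F : Type*) [Field F] :
    SMulCommClass F (TensorMat k F) (TensorMat k F) :=
  ⟨fun c x y => (Algebra.mul_smul_comm c x y).symm⟩

/-- The signs from the individual factors multiply to the cocycle, which is what makes `ψ`
multiplicative. -/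
theorem homogeneous_mul {k : ℕ} (a b : Grp k) :
    homogeneous k F a * homogeneous k F b =
      ((stdCocycle k F).toFun a b : F) • homogeneous k F (a + b) := by
  change PiTensorProduct.tprod F (fun i => monomialXY F (a i)) *
    PiTensorProduct.tprod F (fun i => monomialXY F (b i)) =
      (sgn F (∑ i, (a i).2 * (b i).1) : F) •
        PiTensorProduct.tprod F fun i => monomialXY F (a i + b i)
  rw [PiTensorProduct.tprod_mul_tprod, ← prod_sgn, ← MultilinearMap.map_smul_univ]
  exact congrArg _ (funext fun i => monomialXY_mul _ _)

theorem homogeneous_zero (k : ℕ) : homogeneous k F 0 = 1 := by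
  rw [PiTensorProduct.one_def]
  refine congrArg (PiTensorProduct.tprod F) (funext fun i => ?_)
  simp

/-- Signs of the factors multiply, so exponents add. The exponent `q i` may vary with the factor, as
the second involution requires. -/
theorem tensorInvolution_homogeneous {k : ℕ}
    {σ : Fin k → Involution F (Matrix (Fin 2) (Fin 2) F)}
    {q : Fin k → ZMod 2 × ZMod 2 → ZMod 2}
    (h : ∀ i x, (σ i).toLin (monomialXY F x) = (sgn F (q i x) : F) • monomialXY F x)
    (a : Grp k) :
    (tensorInvolution σ).toLin (homogeneous k F a) =
      (sgn F (∑ i, q i (a i)) : F) • homogeneous k F a := by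
  change PiTensorProduct.map (fun i => (σ i).toLin)
    (PiTensorProduct.tprod F fun i => monomialXY F (a i)) =
      _ • PiTensorProduct.tprod F fun i => monomialXY F (a i)
  rw [PiTensorProduct.map_tprod, ← prod_sgn, ← MultilinearMap.map_smul_univ]
  exact congrArg _ (funext fun i => h i _)

theorem involution0_homogeneous {k : ℕ} (a : Grp k) :
    (involution0 k F).toLin (homogeneous k F a) = (sgn F (f0 a) : F) • homogeneous k F a :=
  tensorInvolution_homogeneous (fun _ => symInvolution_monomialXY) a

theorem involution1_homogeneous {k : ℕ} [NeZero k] (a : Grp k) :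
    (involution1 k F).toLin (homogeneous k F a) = (sgn F (f1 a) : F) • homogeneous k F a := by
  have h := tensorInvolution_homogeneous
    (σ := fun i : Fin k => if i = 0 then skewInvolution F else symInvolution F)
    -- The linear term occurs only in factor 0, and the sum over the factors collapses it to the
    -- linear part of `f1`.
    (q := fun i x => (if i = 0 then x.1 + x.2 else 0) + x.1 * x.2) (fun i x => by
      by_cases hi : i = 0
      · simp only [hi, if_true]
        exact skewInvolution_monomialXY x
      · simp only [hi, if_false, zero_add]
        exact symInvolution_monomialXY x) a
  rw [Finset.sum_add_distrib, Finset.sum_ite_eq' Finset.univ 0, if_pos (Finset.mem_univ _)] at h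
  rw [f1_eq]
  exact h

end Homogeneous

/-! ### The isomorphism of the twisted group algebra with `M(2, F)^{⊗ k}` -/

theorem component_isGrading (k : ℕ) (F : Type*) [Field F] [CharZero F] :
    IsGrading (component k F) := by
  constructor
  · have h := isInternal_span_singleton (homogeneousBasis k F)
    simp only [homogeneousBasis_apply] at h
    exact h
  · intro a b x hx y hy
    obtain ⟨c, rfl⟩ := Submodule.mem_span_singleton.mp hx
    obtain ⟨d, rfl⟩ := Submodule.mem_span_singleton.mp hy
    rw [smul_mul_smul_comm, homogeneous_mul, smul_smul]
    exact Submodule.smul_mem _ _ (Submodule.mem_span_singleton_self _)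

/-- The linear isomorphism that takes `u_a` to the homogeneous element of degree `a`. -/
def twistedLinearEquiv (k : ℕ) (F : Type*) [Field F] [CharZero F] :
    TwistedGroupAlgebra (stdCocycle k F) ≃ₗ[F] TensorMat k F :=
  (TwistedGroupAlgebra.basis (stdCocycle k F)).equiv (homogeneousBasis k F) (Equiv.refl _)

theorem twistedLinearEquiv_u {k : ℕ} {F : Type*} [Field F] [CharZero F] (a : Grp k) :
    twistedLinearEquiv k F (TwistedGroupAlgebra.u _ a) = homogeneous k F a := by
  rw [twistedLinearEquiv, TwistedGroupAlgebra.u, Module.Basis.equiv_apply, Equiv.refl_apply,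
    homogeneousBasis_apply]

/-- The algebra isomorphism `ψ` of the twisted group algebra with `M(2, F)^{⊗ k}`. -/
def twistedAlgEquiv (k : ℕ) (F : Type*) [Field F] [CharZero F] :
    TwistedGroupAlgebra (stdCocycle k F) ≃ₐ[F] TensorMat k F :=
  AlgEquiv.ofLinearEquiv (twistedLinearEquiv k F)
    (by
      -- The unit of the twisted algebra is `u_0` divided by the cocycle value at (0,0), which is 1
      -- here.
      rw [TwistedGroupAlgebra.one_eq, map_smul, twistedLinearEquiv_u, homogeneous_zero]
      have : (stdCocycle k F).toFun 0 0 = 1 := by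
        change sgn F (∑ i, (0 : ZMod 2) * 0) = 1
        simp [sgn_zero]
      rw [this]
      simp)
    (fun x y => by
      induction x using TwistedGroupAlgebra.induction_u with
      | h0 => rw [zero_mul, map_zero, zero_mul]
      | hadd x x' hx hx' => rw [add_mul, map_add, hx, hx', map_add, add_mul]
      | hsmul c x hx => rw [smul_mul_assoc, map_smul, hx, map_smul, smul_mul_assoc]
      | hu a =>
      induction y using TwistedGroupAlgebra.induction_u with
      | h0 => rw [mul_zero, map_zero, mul_zero]
      | hadd x x' hx hx' => rw [mul_add, map_add, hx, hx', map_add, mul_add]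
      | hsmul c x hx => rw [mul_smul_comm, map_smul, hx, map_smul, mul_smul_comm]
      | hu b =>
      rw [TwistedGroupAlgebra.u_mul_u, map_smul, twistedLinearEquiv_u, twistedLinearEquiv_u,
        twistedLinearEquiv_u, homogeneous_mul])

theorem twistedAlgEquiv_u {k : ℕ} {F : Type*} [Field F] [CharZero F] (a : Grp k) :
    twistedAlgEquiv k F (TwistedGroupAlgebra.u _ a) = homogeneous k F a :=
  twistedLinearEquiv_u a

theorem map_rootSpan {k : ℕ} {F : Type*} [Field F] [CharZero F] (R : Set (Grp k)) :
    (rootSpan (stdCocycle k F) R).map (twistedAlgEquiv k F).toLinearMap =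
      Submodule.span F (homogeneousBasis k F '' R) := by
  rw [rootSpan, Submodule.map_span, Set.image_image]
  congr 1
  refine Set.image_congr fun a _ => ?_
  rw [homogeneousBasis_apply]
  exact twistedAlgEquiv_u a

end

noncomputable section

/-! ### The isomorphism of `M(2, F)^{⊗ k}` with a matrix algebra -/

section Kronecker

variable {k : ℕ} {F : Type*} [Field F]

/-- The Kronecker product as a multilinear map. -/
def kroneckerMultilinear (k : ℕ) (F : Type*) [Field F] :
    MultilinearMap F (fun _ : Fin k => Matrix (Fin 2) (Fin 2) F)
      (Matrix (Fin k → Fin 2) (Fin k → Fin 2) F) where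
  toFun := kronecker
  map_update_add' C i x y := by
    ext r c
    -- Each entry of the Kronecker product is a product of entry functionals, one per factor, hence
    -- multilinear.
    exact ((MultilinearMap.mkPiAlgebra F (Fin k) F).compLinearMap
      fun i => Matrix.entryLinearMap F F (r i) (c i)).map_update_add C i x y
  map_update_smul' C i s x := by
    ext r c
    exact ((MultilinearMap.mkPiAlgebra F (Fin k) F).compLinearMap
      fun i => Matrix.entryLinearMap F F (r i) (c i)).map_update_smul C i s x

theorem kronecker_one : kronecker (1 : Fin k → Matrix (Fin 2) (Fin 2) F) = 1 := by
  ext r c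
  simp only [kronecker, Matrix.of_apply, Pi.one_apply, Matrix.one_apply, Finset.prod_ite_zero,
    Finset.mem_univ, true_imp_iff, Finset.prod_const_one, funext_iff]

/-- A product over the factors of sums over two indices expands into a sum over all index functions,
which is the matrix product. -/
theorem kronecker_mul (C D : Fin k → Matrix (Fin 2) (Fin 2) F) :
    kronecker (C * D) = kronecker C * kronecker D := by
  ext r c
  simp only [kronecker, Matrix.of_apply, Pi.mul_apply, Matrix.mul_apply,
    ← Finset.prod_mul_distrib, Finset.prod_univ_sum, Fintype.piFinset_univ]

theorem kronecker_transpose (C : Fin k → Matrix (Fin 2) (Fin 2) F) :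
    (kronecker C).transpose = kronecker fun i => (C i).transpose := rfl

theorem kronecker_inv_mul {C : Fin k → Matrix (Fin 2) (Fin 2) F} (h : ∀ i, IsUnit (C i).det) :
    kronecker (fun i => (C i)⁻¹) * kronecker C = 1 := by
  rw [← kronecker_mul, ← kronecker_one]
  exact congrArg _ (funext fun i => Matrix.nonsing_inv_mul _ (h i))

theorem kronecker_isUnit_det {C : Fin k → Matrix (Fin 2) (Fin 2) F}
    (h : ∀ i, IsUnit (C i).det) : IsUnit (kronecker C).det :=
  Matrix.isUnit_det_of_left_inverse (kronecker_inv_mul h)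

/-- The algebra homomorphism `C_1 ⊗ ⋯ ⊗ C_k ↦ C_1 ⊗ ⋯ ⊗ C_k` (Kronecker product). -/
def kroneckerAlgHom (k : ℕ) (F : Type*) [Field F] :
    TensorMat k F →ₐ[F] Matrix (Fin k → Fin 2) (Fin k → Fin 2) F :=
  PiTensorProduct.liftAlgHom (kroneckerMultilinear k F) kronecker_one kronecker_mul

theorem kroneckerAlgHom_tprod (C : Fin k → Matrix (Fin 2) (Fin 2) F) :
    kroneckerAlgHom k F (PiTensorProduct.tprod F C) = kronecker C :=
  PiTensorProduct.lift.tprod C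

/-- Tensor products of matrix units give all matrix units of size `2^k`, hence surjectivity of
`kroneckerAlgHom`. -/
theorem kronecker_single (r c : Fin k → Fin 2) :
    kronecker (fun i => Matrix.single (r i) (c i) (1 : F)) = Matrix.single r c 1 := by
  ext r' c'
  simp only [kronecker, Matrix.of_apply, Matrix.single_apply, Finset.prod_ite_zero,
    Finset.mem_univ, true_imp_iff, Finset.prod_const_one, funext_iff, forall_and]

theorem kroneckerAlgHom_surjective : Function.Surjective (kroneckerAlgHom k F) := by
  intro Z
  rw [Matrix.matrix_eq_sum_single Z]
  refine ⟨∑ r, ∑ c, Z r c • PiTensorProduct.tprod F fun i => Matrix.single (r i) (c i) 1, ?_⟩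
  simp only [map_sum, map_smul, kroneckerAlgHom_tprod, kronecker_single, Matrix.smul_single,
    smul_eq_mul, mul_one]

theorem kroneckerAlgHom_bijective [CharZero F] : Function.Bijective (kroneckerAlgHom k F) := by
  have := Module.Finite.of_basis (homogeneousBasis k F)
  -- Both dimensions are `4^k`, so surjectivity implies injectivity.
  have hr : Module.finrank F (TensorMat k F) =
      Module.finrank F (Matrix (Fin k → Fin 2) (Fin k → Fin 2) F) := by
    rw [Module.finrank_eq_card_basis (homogeneousBasis k F), Module.finrank_matrix]
    simp [← mul_pow]
  exact ⟨(LinearMap.injective_iff_surjective_of_finrank_eq_finrank hr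
    (f := (kroneckerAlgHom k F).toLinearMap)).mpr kroneckerAlgHom_surjective,
    kroneckerAlgHom_surjective⟩

/-- The isomorphism of `M(2, F)^{⊗ k}` with the algebra of matrices of size `2^k`. -/
def kroneckerAlgEquiv (k : ℕ) (F : Type*) [Field F] [CharZero F] :
    TensorMat k F ≃ₐ[F] Matrix (Fin k → Fin 2) (Fin k → Fin 2) F :=
  AlgEquiv.ofBijective (kroneckerAlgHom k F) kroneckerAlgHom_bijective

theorem kroneckerAlgEquiv_tprod [CharZero F] (C : Fin k → Matrix (Fin 2) (Fin 2) F) :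
    kroneckerAlgEquiv k F (PiTensorProduct.tprod F C) = kronecker C :=
  kroneckerAlgHom_tprod C

/-- The tensor product of adjoint involutions is the adjoint involution of the tensor product
of the forms. -/
theorem kroneckerAlgEquiv_tensorInvolution [CharZero F]
    {σ : Fin k → Involution F (Matrix (Fin 2) (Fin 2) F)}
    {Φ : Fin k → Matrix (Fin 2) (Fin 2) F} (hdet : ∀ i, IsUnit (Φ i).det)
    (hσ : ∀ i Z, (σ i).toLin Z = (Φ i)⁻¹ * Z.transpose * Φ i) (x : TensorMat k F) :
    kroneckerAlgEquiv k F ((tensorInvolution σ).toLin x) =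
      (kronecker Φ)⁻¹ * (kroneckerAlgEquiv k F x).transpose * kronecker Φ := by
  -- The inverse of the form is the Kronecker product of the inverses, so on pure tensors the claim
  -- can be checked factor by factor.
  rw [Matrix.inv_eq_left_inv (kronecker_inv_mul hdet)]
  induction x using PiTensorProduct.induction_on with
  | add x y hx hy =>
    rw [map_add, map_add, hx, hy, map_add, Matrix.transpose_add, Matrix.mul_add, Matrix.add_mul]
  | smul_tprod r C =>
    have h : (tensorInvolution σ).toLin (PiTensorProduct.tprod F C) =
        PiTensorProduct.tprod F fun i => (Φ i)⁻¹ * (C i).transpose * Φ i :=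
      (PiTensorProduct.map_tprod _ _).trans (congrArg _ (funext fun i => hσ i (C i)))
    rw [map_smul, map_smul, h, map_smul, kroneckerAlgEquiv_tprod, kroneckerAlgEquiv_tprod,
      Matrix.transpose_smul, Matrix.mul_smul, Matrix.smul_mul, kronecker_transpose,
      ← kronecker_mul, ← kronecker_mul]
    rfl

theorem isUnit_det_matPhi1 : IsUnit (matPhi1 F).det := by
  simp [matPhi1, Matrix.det_fin_two]

theorem kroneckerAlgEquiv_involution0 [CharZero F] (x : TensorMat k F) :
    kroneckerAlgEquiv k F ((involution0 k F).toLin x) =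
      (form0 k F)⁻¹ * (kroneckerAlgEquiv k F x).transpose * form0 k F :=
  kroneckerAlgEquiv_tensorInvolution (fun _ => by simp) (fun _ _ => rfl) x

theorem form0_eq_one : form0 k F = 1 := kronecker_one

theorem isUnit_det_form1_factor [NeZero k] (i : Fin k) :
    IsUnit (if i = 0 then matPhi1 F else 1).det := by
  split_ifs
  · exact isUnit_det_matPhi1
  · simp

theorem kroneckerAlgEquiv_involution1 [NeZero k] [CharZero F] (x : TensorMat k F) :
    kroneckerAlgEquiv k F ((involution1 k F).toLin x) =
      (form1 k F)⁻¹ * (kroneckerAlgEquiv k F x).transpose * form1 k F :=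
  kroneckerAlgEquiv_tensorInvolution isUnit_det_form1_factor
    (fun i _ => by by_cases hi : i = 0 <;> simp only [hi, if_true, if_false] <;> rfl) x

/-- The bijection of the standard basis of `(F²)^{⊗ (m + 1)}` with two copies of
`{0, …, 2^m - 1}`, given by the first factor. -/
def consEquivSum (m : ℕ) : (Fin (m + 1) → Fin 2) ≃ Fin (2 ^ m) ⊕ Fin (2 ^ m) :=
  (Fin.consEquiv fun _ => Fin 2).symm.trans
    ((finTwoEquiv.prodCongr finFunctionFinEquiv).trans (Equiv.boolProdEquivSum _))

theorem consEquivSum_of_zero {m : ℕ} {r : Fin (m + 1) → Fin 2} (h : r 0 = 0) :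
    consEquivSum m r = Sum.inl (finFunctionFinEquiv (Fin.tail r)) := by
  simp [consEquivSum, Fin.consEquiv, h]
  rfl

theorem consEquivSum_of_one {m : ℕ} {r : Fin (m + 1) → Fin 2} (h : r 0 = 1) :
    consEquivSum m r = Sum.inr (finFunctionFinEquiv (Fin.tail r)) := by
  simp [consEquivSum, Fin.consEquiv, h]
  rfl

theorem form1_succ_apply {m : ℕ} (r c : Fin (m + 1) → Fin 2) :
    form1 (m + 1) F r c =
      matPhi1 F (r 0) (c 0) * (1 : Matrix _ _ F) (Fin.tail r) (Fin.tail c) := by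
  have h : ∀ i : Fin m, (if i.succ = 0 then matPhi1 F else 1) = 1 := fun i =>
    if_neg (Fin.succ_ne_zero i)
  rw [← kronecker_one, form1]
  simp only [kronecker, Matrix.of_apply, Fin.prod_univ_succ, if_true, h, Pi.one_apply]
  rfl

/-- The first factor selects the block and the remaining ones contribute the identity. `Matrix.J`
has -1 in its upper right block where `Φ₁` has 1, whence the sign. -/
theorem form1_eq_neg_J (m : ℕ) :
    form1 (m + 1) F = -(Matrix.J (Fin (2 ^ m)) F).submatrix (consEquivSum m) (consEquivSum m) := by
  ext r c
  have h2 : ∀ x : Fin 2, x = 0 ∨ x = 1 := by decide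
  rw [form1_succ_apply, Matrix.neg_apply, Matrix.submatrix_apply]
  rcases h2 (r 0) with hr | hr <;> rcases h2 (c 0) with hc | hc <;>
    simp [hr, hc, consEquivSum_of_zero, consEquivSum_of_one, matPhi1, Matrix.J, Matrix.one_apply,
      neg_ite]

/-- As `k` is nonzero, `k - 1` is a true predecessor and the two blocks together have size `2^k`. -/
theorem exists_form1_eq_neg_J (k : ℕ) [NeZero k] (F : Type*) [Field F] :
    ∃ e : (Fin k → Fin 2) ≃ Fin (2 ^ (k - 1)) ⊕ Fin (2 ^ (k - 1)),
      form1 k F = -(Matrix.J (Fin (2 ^ (k - 1))) F).submatrix e e := by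
  obtain ⟨m, rfl⟩ := Nat.exists_eq_succ_of_ne_zero (NeZero.ne k)
  exact ⟨consEquivSum m, form1_eq_neg_J m⟩

theorem form1_transpose [NeZero k] : (form1 k F).transpose = -form1 k F := by
  obtain ⟨e, he⟩ := exists_form1_eq_neg_J k F
  rw [he, Matrix.transpose_neg, Matrix.transpose_submatrix, Matrix.J_transpose]
  rfl

theorem exists_algEquiv_involution0 (k : ℕ) (F : Type*) [Field F] [CharZero F] :
    ∃ e : TensorMat k F ≃ₐ[F] Matrix (Fin (2 ^ k)) (Fin (2 ^ k)) F,
      ∀ x, e ((involution0 k F).toLin x) =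
        (adjointInvolution (1 : Matrix (Fin (2 ^ k)) (Fin (2 ^ k)) F) (by simp)
          (Or.inl (by simp))).toLin (e x) := by
  refine ⟨(kroneckerAlgEquiv k F).trans (Matrix.reindexAlgEquiv F F finFunctionFinEquiv),
    fun x => ?_⟩
  change Matrix.reindex _ _ (kroneckerAlgEquiv k F _) =
    (1 : Matrix (Fin (2 ^ k)) (Fin (2 ^ k)) F)⁻¹ * (Matrix.reindex _ _ (kroneckerAlgEquiv k F x)).transpose * 1
  rw [kroneckerAlgEquiv_involution0, form0_eq_one]
  simp

theorem exists_algEquiv_involution1 (k : ℕ) [NeZero k] (F : Type*) [Field F] [CharZero F] :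
    ∃ e : TensorMat k F ≃ₐ[F] Matrix (Fin (2 ^ (k - 1)) ⊕ Fin (2 ^ (k - 1)))
        (Fin (2 ^ (k - 1)) ⊕ Fin (2 ^ (k - 1))) F,
      ∀ x, e ((involution1 k F).toLin x) =
        (adjointInvolution (Matrix.J (Fin (2 ^ (k - 1))) F) (Matrix.isUnit_det_J _ F)
          (Or.inr (Matrix.J_transpose _ F))).toLin (e x) := by
  obtain ⟨e, he⟩ := exists_form1_eq_neg_J k F
  refine ⟨(kroneckerAlgEquiv k F).trans (Matrix.reindexAlgEquiv F F e), fun x => ?_⟩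
  have hJ : Matrix.reindex e e (form1 k F) = -Matrix.J (Fin (2 ^ (k - 1))) F := by
    rw [he]
    ext i j
    simp
  have hJ' : Matrix.reindex e e (form1 k F)⁻¹ = -(Matrix.J (Fin (2 ^ (k - 1))) F)⁻¹ := by
    rw [← Matrix.inv_reindex, hJ]
    refine Matrix.inv_eq_left_inv ?_
    rw [neg_mul_neg, Matrix.nonsing_inv_mul _ (Matrix.isUnit_det_J _ F)]
  change Matrix.reindexAlgEquiv F F e (kroneckerAlgEquiv k F _) =
    (Matrix.J _ F)⁻¹ * (Matrix.reindex e e (kroneckerAlgEquiv k F x)).transpose * Matrix.J _ F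
  rw [kroneckerAlgEquiv_involution1, map_mul, map_mul]
  simp only [Matrix.coe_reindexAlgEquiv]
  -- The signs of the form and of its inverse cancel, so `-J` and `J` define the same involution.
  rw [hJ, hJ', Matrix.transpose_reindex, neg_mul, neg_mul_neg]

end Kronecker

end

/-! ### The gradings and the isomorphisms induced by `ψ` -/

section Graded

variable {k : ℕ} {F : Type*} [Field F] [CharZero F] {σ : Involution F (TensorMat k F)}
  {q : Grp k → ZMod 2}
  (hσ : ∀ a, σ.toLin (homogeneous k F a) = (sgn F (q a) : F) • homogeneous k F a)

theorem component_eq_span_basis :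
    component k F = fun a => Submodule.span F {homogeneousBasis k F a} := by
  funext a
  rw [homogeneousBasis_apply, component]

include hσ

theorem involution_homogeneousBasis (a : Grp k) :
    σ.toLin (homogeneousBasis k F a) = (sgn F (q a) : F) • homogeneousBasis k F a := by
  rw [homogeneousBasis_apply, hσ]

theorem component_map_involution (a : Grp k) :
    (component k F a).map σ.toLin = component k F a := by
  rw [component_eq_span_basis]
  exact map_span_singleton_eq (involution_homogeneousBasis hσ) a

theorem isGradedSubspace_symPart : IsGradedSubspace (component k F) σ.symPart := by
  rw [component_eq_span_basis, symPart_eq_span (involution_homogeneousBasis hσ)]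
  exact isGradedSubspace_span_image _ _

theorem gradedSupport_symPart : gradedSupport (component k F) σ.symPart = {a | q a = 0} := by
  rw [component_eq_span_basis, symPart_eq_span (involution_homogeneousBasis hσ)]
  exact gradedSupport_span_image _ _

theorem isGradedSubspace_skewPart : IsGradedSubspace (component k F) σ.skewPart := by
  rw [component_eq_span_basis, skewPart_eq_span (involution_homogeneousBasis hσ)]
  exact isGradedSubspace_span_image _ _

theorem exists_jordanEquiv_of_involution
    (hR : IsSkewRootSystemJordan (stdBichar k F) {a | q a = 0}) :
    ∃ e : jordanOfRoots (stdCocycle_correspondsTo k F) hR ≃ₗ[F] σ.H,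
      (∀ x y, e (x * y) = e x * e y) ∧
      ∀ x, SymAlg.unsym (e x : SymAlg (TensorMat k F)) =
        twistedAlgEquiv k F (SymAlg.unsym x.1) :=
  exists_jordanEquiv_of_map_eq (twistedAlgEquiv k F) _ _
    ((map_rootSpan _).trans (symPart_eq_span (involution_homogeneousBasis hσ)).symm)

variable (hq : q 0 = 0)

include hq

/-- Since `q 0 = 0`, excluding 0 from the roots removes nothing from the level set `q a = 1`. -/
theorem skewPart_eq_span_of_zero :
    σ.skewPart = Submodule.span F (homogeneousBasis k F '' {a | a ≠ 0 ∧ q a = 1}) := by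
  rw [skewPart_eq_span (involution_homogeneousBasis hσ)]
  congr 2
  ext a
  refine ⟨fun ha => ⟨?_, ha⟩, fun ha => ha.2⟩
  rintro rfl
  exact zero_ne_one (hq.symm.trans ha)

theorem gradedSupport_skewPart :
    gradedSupport (component k F) σ.skewPart = {a | a ≠ 0 ∧ q a = 1} := by
  rw [component_eq_span_basis, skewPart_eq_span_of_zero hσ hq]
  exact gradedSupport_span_image _ _

theorem exists_lieEquiv_of_involution
    (hR : IsSkewRootSystemLie (stdBichar k F) {a | a ≠ 0 ∧ q a = 1}) :
    ∃ e : lieOfRoots (stdCocycle_correspondsTo k F) hR ≃ₗ⁅F⁆ σ.K,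
      ∀ x, (e x : TensorMat k F) = twistedAlgEquiv k F x :=
  exists_lieEquiv_of_map_eq (twistedAlgEquiv k F) _ _
    ((map_rootSpan _).trans (skewPart_eq_span_of_zero hσ hq).symm)

end Graded

/-! ### The classical Lie algebras and the main theorem. -/

theorem nonempty_K_involution0 (k : ℕ) (F : Type*) [Field F] [CharZero F] :
    Nonempty ((involution0 k F).K ≃ₗ⁅F⁆ LieAlgebra.Orthogonal.so (Fin (2 ^ k)) F) := by
  obtain ⟨e, he⟩ := exists_algEquiv_involution0 k F
  have h := nonempty_K_lieEquiv he
  rwa [adjointInvolution_K_eq] at h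

theorem nonempty_K_involution1 (k : ℕ) [NeZero k] (F : Type*) [Field F] [CharZero F] :
    Nonempty ((involution1 k F).K ≃ₗ⁅F⁆ LieAlgebra.Symplectic.sp (Fin (2 ^ (k - 1))) F) := by
  obtain ⟨e, he⟩ := exists_algEquiv_involution1 k F
  have h := nonempty_K_lieEquiv he
  rwa [adjointInvolution_K_eq] at h

end SkewRoot

theorem mainTheorem9 (F : Type*) [Field F] [IsAlgClosed F] [CharZero F] (k : ℕ) [NeZero k] :
    -- the symplectic abelian group is nonsingular, and `M` is graded by it
    (stdBichar k F).Nonsingular ∧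
    IsGrading (component k F) ∧
    ∃ Θ : TensorMat k F ≃ₐ[F] Matrix (Fin k → Fin 2) (Fin k → Fin 2) F,
    (∀ C, Θ (PiTensorProduct.tprod F C) = kronecker C) ∧
    ∃ ψ : TwistedGroupAlgebra (stdCocycle k F) ≃ₐ[F] TensorMat k F,
    (∀ a, ψ (TwistedGroupAlgebra.u _ a) = homogeneous k F a) ∧
    -- every factor `φ_i` is symmetric with matrix `I₂`
    (((form0 k F).transpose = form0 k F ∧ IsUnit (form0 k F).det ∧
        ∀ x, Θ ((involution0 k F).toLin x) = (form0 k F)⁻¹ * (Θ x).transpose * form0 k F) ∧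
      Nonempty ((involution0 k F).K ≃ₗ⁅F⁆ LieAlgebra.Orthogonal.so (Fin (2 ^ k)) F) ∧
      JordanIso (involution0 k F).H (jordanSymmetric (Fin (2 ^ k)) F) ∧
      -- compatibility with the grading, and the supports
      (∀ a, (component k F a).map (involution0 k F).toLin = component k F a) ∧
      IsGradedSubspace (component k F) (involution0 k F).skewPart ∧
      IsGradedSubspace (component k F) (involution0 k F).symPart ∧
      gradedSupport (component k F) (involution0 k F).skewPart = R0minus k ∧
      gradedSupport (component k F) (involution0 k F).symPart = R0plus k ∧
      -- the isomorphisms that `ψ` induces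
      (2 ≤ k → ∃ hR : IsSkewRootSystemLie (stdBichar k F) (R0minus k),
        (∃ e : lieOfRoots (stdCocycle_correspondsTo k F) hR ≃ₗ⁅F⁆ (involution0 k F).K,
          ∀ x, (e x : TensorMat k F) = ψ x) ∧
        Nonempty (lieOfRoots (stdCocycle_correspondsTo k F) hR ≃ₗ⁅F⁆
          LieAlgebra.Orthogonal.so (Fin (2 ^ k)) F)) ∧
      ∃ hR : IsSkewRootSystemJordan (stdBichar k F) (R0plus k),
        ∃ e : jordanOfRoots (stdCocycle_correspondsTo k F) hR ≃ₗ[F] (involution0 k F).H,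
          (∀ x y, e (x * y) = e x * e y) ∧
          ∀ x, SymAlg.unsym (e x : SymAlg (TensorMat k F)) = ψ (SymAlg.unsym x.1)) ∧
    -- `φ_1` is skew-symmetric with matrix `Φ₁`, the other factors have matrix `I₂`
    (((form1 k F).transpose = -form1 k F ∧ IsUnit (form1 k F).det ∧
        ∀ x, Θ ((involution1 k F).toLin x) = (form1 k F)⁻¹ * (Θ x).transpose * form1 k F) ∧
      Nonempty ((involution1 k F).K ≃ₗ⁅F⁆ LieAlgebra.Symplectic.sp (Fin (2 ^ (k - 1))) F) ∧
      JordanIso (involution1 k F).H (jordanSymplectic (Fin (2 ^ (k - 1))) F) ∧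
      -- compatibility with the grading, and the supports
      (∀ a, (component k F a).map (involution1 k F).toLin = component k F a) ∧
      IsGradedSubspace (component k F) (involution1 k F).skewPart ∧
      IsGradedSubspace (component k F) (involution1 k F).symPart ∧
      gradedSupport (component k F) (involution1 k F).skewPart = R1minus k ∧
      gradedSupport (component k F) (involution1 k F).symPart = R1plus k ∧
      -- the isomorphisms that `ψ` induces
      (∃ hR : IsSkewRootSystemLie (stdBichar k F) (R1minus k),
        (∃ e : lieOfRoots (stdCocycle_correspondsTo k F) hR ≃ₗ⁅F⁆ (involution1 k F).K,
          ∀ x, (e x : TensorMat k F) = ψ x) ∧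
        Nonempty (lieOfRoots (stdCocycle_correspondsTo k F) hR ≃ₗ⁅F⁆
          LieAlgebra.Symplectic.sp (Fin (2 ^ (k - 1))) F)) ∧
      (2 ≤ k → ∃ hR : IsSkewRootSystemJordan (stdBichar k F) (R1plus k),
        ∃ e : jordanOfRoots (stdCocycle_correspondsTo k F) hR ≃ₗ[F] (involution1 k F).H,
          (∀ x y, e (x * y) = e x * e y) ∧
          ∀ x, SymAlg.unsym (e x : SymAlg (TensorMat k F)) = ψ (SymAlg.unsym x.1))) := by
  refine ⟨stdBichar_nonsingular k F, component_isGrading k F, kroneckerAlgEquiv k F,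
    kroneckerAlgEquiv_tprod, twistedAlgEquiv k F, twistedAlgEquiv_u, ?_, ?_⟩
  -- For the grading, the supports and the isomorphisms induced by `ψ`, only the sign rule `hσ` and
  -- the quadratic form matter; the classical types come from the matrix model.
  · have hσ := involution0_homogeneous (k := k) (F := F)
    have hq := eq_zero_of_add_identity (f0_add (k := k))
    refine ⟨⟨by rw [form0_eq_one, Matrix.transpose_one], by simp [form0_eq_one],
      kroneckerAlgEquiv_involution0⟩, nonempty_K_involution0 k F, ?_,
      component_map_involution hσ, isGradedSubspace_skewPart hσ, isGradedSubspace_symPart hσ,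
      gradedSupport_skewPart hσ hq, gradedSupport_symPart hσ, fun hk => ?_, ?_⟩
    · obtain ⟨e, he⟩ := exists_algEquiv_involution0 k F
      exact jordanIso_H he
    · have hR := isSkewRootSystemLie_of_quadratic (F := F) f0_add (closure_R0minus hk)
      obtain ⟨e, he⟩ := exists_lieEquiv_of_involution hσ hq hR
      exact ⟨hR, ⟨e, he⟩, (nonempty_K_involution0 k F).map e.trans⟩
    · have hR := isSkewRootSystemJordan_of_quadratic (F := F) f0_add (closure_R0plus (k := k))
      exact ⟨hR, exists_jordanEquiv_of_involution hσ hR⟩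
  · have hσ := involution1_homogeneous (k := k) (F := F)
    have hq := eq_zero_of_add_identity (f1_add (k := k))
    refine ⟨⟨form1_transpose, kronecker_isUnit_det isUnit_det_form1_factor,
      kroneckerAlgEquiv_involution1⟩, nonempty_K_involution1 k F, ?_,
      component_map_involution hσ, isGradedSubspace_skewPart hσ, isGradedSubspace_symPart hσ,
      gradedSupport_skewPart hσ hq, gradedSupport_symPart hσ, ?_, fun hk => ?_⟩
    · obtain ⟨e, he⟩ := exists_algEquiv_involution1 k F
      exact jordanIso_H he
    · have hR := isSkewRootSystemLie_of_quadratic (F := F) f1_add (closure_R1minus (k := k))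
      obtain ⟨e, he⟩ := exists_lieEquiv_of_involution hσ hq hR
      exact ⟨hR, ⟨e, he⟩, (nonempty_K_involution1 k F).map e.trans⟩
    · have hR := isSkewRootSystemJordan_of_quadratic (F := F) f1_add (closure_R1plus hk)
      exact ⟨hR, exists_jordanEquiv_of_involution hσ hR⟩
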